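/- **Setting.** A Feynman graph is a finite multigraph without isolated vertices (possibly disconnected or empty, up to isomorphism), with edge masses $m_e\ge 0$, external momenta at the vertices that are, on each connected component, conserved and non-exceptional (only the empty set and the set of all external vertices of the component have total momentum zero; external vertices are those with nonzero momentum), and arbitrary real edge and vertex weights $\omega(e),\omega(v)$. Its superficial degree of divergence in spacetime dimension $D$ is $\omega(\Gamma)=D\,L_\Gamma+\sum_v\omega(v)-\sum_e\omega(e)$, with $L_\Gamma$ the number of loops. A graph is scaleless if all its external momenta and masses vanish. A subgraph $\gamma\subset\Gamma$ is given by a set of edges. For connected $\Gamma$ it is mass-momentum-spanning if it contains all massive edges of $\Gamma$ and one connected component of $\gamma$ contains all external vertices of $\Gamma$; then it inherits the masses and external momenta of $\Gamma$, and otherwise it inherits none. For disconnected $\Gamma$ this is read separately in each connected component. A graph is motic if each of its proper mass-momentum-spanning subgraphs has strictly fewer loops. In $\Gamma/\gamma$ each component of $\gamma$ is contracted to a vertex of weight $0$ that carries the total momentum (components of $\Gamma$ that are contracted completely are dropped). Let $\mathcal M$ be the $\mathbb Q$-algebra spanned by motic graphs, with disjoint union as product, unit $\mathbb I=\emptyset$,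 coproduct $\Delta(\Gamma)=\sum_\gamma\gamma\otimes\Gamma/\gamma$ (sum over motic subgraphs), $\Delta^{(2)}=(\Delta\otimes\mathrm{id})\circ\Delta$, and antipode $S$, given by $S(\mathbb I)=\mathbb I$ and $S(\Gamma)=-\Gamma-\sum_{\emptyset\ne\gamma\subsetneq\Gamma}S(\gamma)\,\Gamma/\gamma$ (sum over motic subgraphs). Let $\rho^{UV}$ be the linear projection of $\mathcal M$ onto the span of the graphs all of whose connected components $\delta$ are 1PI with $\omega(\delta)\ge0$, and $\rho^{IR}$ the one onto the span of the scaleless graphs all of whose connected components satisfy $\omega(\delta)\le0$; both send all other graphs to $0$. Let $\mathcal A$ be a commutative $\mathbb Q$-algebra and $K:\mathcal A\to\mathcal A$ a $\mathbb Q$-linear projection ($K^2=K$) whose image is closed under multiplication (for example, Laurent series in $\epsilon$ and minimal subtraction). Let $\phi:\mathcal M\to\mathcal A$ be linear with $\phi(\mathbb I)=1$ and $\phi(\Lambda)=0$ for every non-empty scaleless motic graph $\Lambda$ (the Feynman rules). Let $Z,\widetilde Z:\mathcal M\to\mathcal A$ be UV and IR counterterm maps for $\phi$ and $K$, i.e.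 unital algebra homomorphisms such that for all motic $\Gamma\neq\mathbb I$ $$Z(\Gamma)=-K\circ m^{(2)}_{\mathcal A}\circ(Z\otimes\phi\otimes\widetilde Z)\circ(\Delta^{(2)}-\mathrm{id}\otimes\mathbb I\otimes\mathbb I)\circ\rho^{UV}(\Gamma),$$ $$\widetilde Z(\Gamma)=-K\circ m^{(2)}_{\mathcal A}\circ(Z\otimes\phi\otimes\widetilde Z)\circ(\Delta^{(2)}-\mathbb I\otimes\mathbb I\otimes\mathrm{id})\circ\rho^{IR}(\Gamma).$$ **Theorem.** Let $\Gamma$ be a scaleless motic graph that is log-divergent (every connected component $\delta$ has $\omega(\delta)=0$) and has only log-subdivergences (every motic subgraph all of whose connected components are 1PI with $\omega\ge0$ has all components with $\omega=0$). Then $$\widetilde Z(\Gamma)=Z(S(\Gamma))\qquad\text{and}\qquad Z(\Gamma)=\widetilde Z(S(\Gamma)).$$ -/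

import Mathlib

open scoped TensorProduct NNReal
/-- The equivalence relation "connected by edges in `μ`" on the vertices. -/
def edgeConn {V E : Type} (ends : E → Sym2 V) (μ : Set E) : Setoid V :=
  Relation.EqvGen.setoid fun v w => ∃ e ∈ μ, ends e = s(v, w)

/-- Number of loops (first Betti number) of the subgraph with edge set `μ`; isolated vertices do
not contribute. -/
noncomputable def loopNumber {V E : Type} (ends : E → Sym2 V) (μ : Set E) : ℤ :=
  Nat.card μ + Nat.card (Quotient (edgeConn ends μ)) - Nat.card V

theorem edgeConn_le {V E : Type} {ends : E → Sym2 V} {μ : Set E} {r : Setoid V}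
    (h : ∀ e ∈ μ, ∀ v w, ends e = s(v, w) → r v w) : edgeConn ends μ ≤ r :=
  Setoid.eqvGen_le fun v w ⟨e, he, hvw⟩ => h e he v w hvw

theorem edgeConn_of {V E : Type} {ends : E → Sym2 V} {μ : Set E} {e : E} (he : e ∈ μ) {v w : V}
    (h : ends e = s(v, w)) : edgeConn ends μ v w :=
  Relation.EqvGen.rel _ _ ⟨e, he, h⟩

theorem edgeConn_mem {V E : Type} {ends : E → Sym2 V} {μ : Set E} {e : E} (he : e ∈ μ) {v w : V}
    (hv : v ∈ ends e) (hw : w ∈ ends e) : edgeConn ends μ v w := by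
  by_cases h : v = w
  · subst h; exact (edgeConn ends μ).refl' v
  · exact edgeConn_of he ((Sym2.mem_and_mem_iff h).1 ⟨hv, hw⟩)

theorem edgeConn_mono {V E : Type} {ends : E → Sym2 V} {μ ν : Set E} (h : μ ⊆ ν) :
    edgeConn ends μ ≤ edgeConn ends ν :=
  edgeConn_le fun _ he _ _ hvw => edgeConn_of (h he) hvw

/-- Vertices of the subgraph with edge set `γ`. -/
abbrev SubV {V E : Type} (ends : E → Sym2 V) (γ : Set E) : Type := {v : V // ∃ e ∈ γ, v ∈ ends e}

def subEnds {V E : Type} (ends : E → Sym2 V) (γ : Set E) (e : γ) : Sym2 (SubV ends γ) :=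
  (ends e).attachWith fun _ hv => ⟨e, e.2, hv⟩

/-- Vertices of the contracted graph: classes of vertices joined by `γ`; classes without
remaining edges (fully contracted components) are dropped. -/
abbrev QuotV {V E : Type} (ends : E → Sym2 V) (γ : Set E) : Type :=
  {c : Quotient (edgeConn ends γ) // ∃ e ∉ γ, c ∈ (ends e).map (Quotient.mk _)}

def quotEnds {V E : Type} (ends : E → Sym2 V) (γ : Set E) (e : (γᶜ : Set E)) :
    Sym2 (QuotV ends γ) :=
  ((ends e).map (Quotient.mk _)).attachWith fun _ hc => ⟨e, e.2, hc⟩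

theorem subEnds_eq_iff {V E : Type} {ends : E → Sym2 V} {γ : Set E} {e : γ} {v w : SubV ends γ} :
    subEnds ends γ e = s(v, w) ↔ ends e = s(v.1, w.1) := by
  rw [← (Sym2.map.injective Subtype.val_injective).eq_iff, subEnds, Sym2.attachWith_map_subtypeVal]
  rfl

theorem quotEnds_eq_iff {V E : Type} {ends : E → Sym2 V} {γ : Set E} {e : (γᶜ : Set E)}
    {v w : QuotV ends γ} :
    quotEnds ends γ e = s(v, w) ↔ (ends e).map (Quotient.mk _) = s(v.1, w.1) := by
  rw [← (Sym2.map.injective Subtype.val_injective).eq_iff, quotEnds, Sym2.attachWith_map_subtypeVal]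
  rfl

theorem sub_edgeConn {V E : Type} {ends : E → Sym2 V} {γ : Set E} {μ : Set γ}
    {v w : SubV ends γ} :
    edgeConn (subEnds ends γ) μ v w ↔ edgeConn ends (Subtype.val '' μ) v.1 w.1 := by
  constructor
  · have : edgeConn (subEnds ends γ) μ ≤ (edgeConn ends (Subtype.val '' μ)).comap Subtype.val :=
      edgeConn_le fun e he v w hvw => edgeConn_of (Set.mem_image_of_mem _ he) (subEnds_eq_iff.1 hvw)
    exact fun h => this h
  · classical
    let f : V → Quotient (edgeConn (subEnds ends γ) μ) ⊕ V := fun v =>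
      if h : ∃ e ∈ γ, v ∈ ends e then .inl (Quotient.mk _ ⟨v, h⟩) else .inr v
    have : edgeConn ends (Subtype.val '' μ) ≤ Setoid.ker f := by
      refine edgeConn_le ?_
      rintro _ ⟨e, he, rfl⟩ v w hvw
      have hv : ∃ e ∈ γ, v ∈ ends e := ⟨e, e.2, by simp [hvw]⟩
      have hw : ∃ e ∈ γ, w ∈ ends e := ⟨e, e.2, by simp [hvw]⟩
      change f v = f w
      simp only [f]
      rw [dif_pos hv, dif_pos hw]
      exact congrArg _ (Quotient.sound (edgeConn_of he (subEnds_eq_iff.2 hvw)))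
    intro h
    have h' : f v.1 = f w.1 := this h
    simp only [f] at h'
    rw [dif_pos v.2, dif_pos w.2] at h'
    exact Quotient.exact (Sum.inl.inj h')

/-- The edges `γ ∪ μ` as a subset of all edges. -/
def liftSet {E : Type} (γ : Set E) (μ : Set (γᶜ : Set E)) : Set E := γ ∪ Subtype.val '' μ

noncomputable def quotMap {V E : Type} (ends : E → Sym2 V) (γ : Set E) (μ : Set (γᶜ : Set E)) (v : V) :
    Quotient (edgeConn (quotEnds ends γ) μ) ⊕
      {c : Quotient (edgeConn ends γ) // ¬ ∃ e ∉ γ, c ∈ (ends e).map (Quotient.mk _)} :=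
  open Classical in
  if h : ∃ e ∉ γ, Quotient.mk _ v ∈ (ends e).map (Quotient.mk (edgeConn ends γ)) then
    .inl (Quotient.mk _ ⟨Quotient.mk _ v, h⟩) else .inr ⟨Quotient.mk _ v, h⟩

theorem quotMap_eq_iff {V E : Type} {ends : E → Sym2 V} {γ : Set E} {μ : Set (γᶜ : Set E)}
    {v w : V} :
    quotMap ends γ μ v = quotMap ends γ μ w ↔ edgeConn ends (liftSet γ μ) v w := by
  have hγ : edgeConn ends γ ≤ edgeConn ends (liftSet γ μ) := edgeConn_mono Set.subset_union_left
  constructor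
  · let g : Quotient (edgeConn ends γ) → Quotient (edgeConn ends (liftSet γ μ)) :=
      Quotient.map' id fun _ _ h => hγ h
    have hg : edgeConn (quotEnds ends γ) μ ≤ Setoid.ker (fun c : QuotV ends γ => g c.1) := by
      refine edgeConn_le ?_
      rintro e he ⟨c, hc⟩ ⟨d, hd⟩ h
      have h := quotEnds_eq_iff.1 h
      have hc' : c ∈ (ends e).map (Quotient.mk _) := by rw [h]; simp
      have hd' : d ∈ (ends e).map (Quotient.mk _) := by rw [h]; simp
      obtain ⟨a, ha, rfl⟩ := Sym2.mem_map.1 hc'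
      obtain ⟨b, hb, rfl⟩ := Sym2.mem_map.1 hd'
      exact Quotient.sound 
        (edgeConn_mem (Set.mem_union_right _ (Set.mem_image_of_mem _ he)) ha hb)
    intro h
    unfold quotMap at h
    split_ifs at h with h1 h2 h2
    · have h := Quotient.exact (Sum.inl.inj h)
      exact Quotient.exact (hg h)
    · have h := Sum.inr.inj h
      exact hγ (Quotient.exact (congrArg Subtype.val h))
  · have : edgeConn ends (liftSet γ μ) ≤ Setoid.ker (quotMap ends γ μ) := by
      refine edgeConn_le ?_
      rintro e (he | ⟨e, he, rfl⟩) v w hvw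
      · have : (Quotient.mk (edgeConn ends γ) v) = Quotient.mk _ w :=
          Quotient.sound (edgeConn_of he hvw)
        change quotMap ends γ μ v = quotMap ends γ μ w
        unfold quotMap
        generalize Quotient.mk (edgeConn ends γ) v = c at this
        subst this
        rfl
      · have hv : ∃ e ∉ γ, Quotient.mk _ v ∈ (ends e).map (Quotient.mk (edgeConn ends γ)) :=
          ⟨e, e.2, by simp [hvw]⟩
        have hw : ∃ e ∉ γ, Quotient.mk _ w ∈ (ends e).map (Quotient.mk (edgeConn ends γ)) :=
          ⟨e, e.2, by simp [hvw]⟩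
        change quotMap ends γ μ v = quotMap ends γ μ w
        unfold quotMap
        rw [dif_pos hv, dif_pos hw]
        exact congrArg _ (Quotient.sound (edgeConn_of he (quotEnds_eq_iff.2 (by simp [hvw]))))
    exact fun h => this h

theorem quotMap_surjective {V E : Type} (ends : E → Sym2 V) (γ : Set E) (μ : Set (γᶜ : Set E)) :
    Function.Surjective (quotMap ends γ μ) := by
  rintro (c | ⟨c, hc⟩)
  · obtain ⟨⟨c, hc⟩, rfl⟩ := Quotient.exists_rep c
    obtain ⟨v, rfl⟩ := Quotient.exists_rep c
    exact ⟨v, by unfold quotMap; exact dif_pos hc⟩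
  · obtain ⟨v, rfl⟩ := Quotient.exists_rep c
    exact ⟨v, by unfold quotMap; exact dif_neg hc⟩

theorem loopNumber_quot {V E : Type} [Finite V] [Finite E] (ends : E → Sym2 V) (γ : Set E)
    (μ : Set (γᶜ : Set E)) :
    loopNumber (quotEnds ends γ) μ = loopNumber ends (liftSet γ μ) - loopNumber ends γ := by
  have e1 : Nat.card (Quotient (edgeConn ends (liftSet γ μ))) =
      Nat.card (Quotient (edgeConn (quotEnds ends γ) μ)) +
      Nat.card {c : Quotient (edgeConn ends γ) //
        ¬ ∃ e ∉ γ, c ∈ (ends e).map (Quotient.mk _)} := by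
    rw [← Nat.card_sum]
    have : edgeConn ends (liftSet γ μ) = Setoid.ker (quotMap ends γ μ) :=
      Setoid.ext fun v w => quotMap_eq_iff.symm
    rw [this]
    exact Nat.card_congr (Setoid.quotientKerEquivOfSurjective _ (quotMap_surjective ends γ μ))
  have e2 : Nat.card (Quotient (edgeConn ends γ)) = Nat.card (QuotV ends γ) +
      Nat.card {c : Quotient (edgeConn ends γ) //
        ¬ ∃ e ∉ γ, c ∈ (ends e).map (Quotient.mk _)} := by
    classical
    rw [← Nat.card_sum]
    exact Nat.card_congr (Equiv.sumCompl _).symm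
  have e3 : Nat.card (liftSet γ μ) = Nat.card γ + Nat.card μ := by
    rw [Nat.card_coe_set_eq, Nat.card_coe_set_eq, Nat.card_coe_set_eq, liftSet,
      Set.ncard_union_eq, Set.ncard_image_of_injective _ Subtype.val_injective]
    rw [Set.disjoint_left]
    rintro x hx ⟨y, -, rfl⟩
    exact y.2 hx
  unfold loopNumber
  rw [e1, e2, e3]
  push_cast
  ring

def sumEnds {V E W F : Type} (ends : E → Sym2 V) (ends' : F → Sym2 W) : E ⊕ F → Sym2 (V ⊕ W) :=
  Sum.elim (fun e => (ends e).map Sum.inl) (fun e => (ends' e).map Sum.inr)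

theorem sum_edgeConn {V E W F : Type} (ends : E → Sym2 V) (ends' : F → Sym2 W) (μ : Set (E ⊕ F)) :
    edgeConn (sumEnds ends ends') μ = Setoid.ker (Sum.map
      (Quotient.mk (edgeConn ends (Sum.inl ⁻¹' μ))) (Quotient.mk (edgeConn ends' (Sum.inr ⁻¹' μ)))) := by
  apply le_antisymm
  · refine edgeConn_le ?_
    have key : ∀ e ∈ μ, ∀ v ∈ sumEnds ends ends' e, ∀ w ∈ sumEnds ends ends' e,
        Sum.map (Quotient.mk (edgeConn ends (Sum.inl ⁻¹' μ)))
          (Quotient.mk (edgeConn ends' (Sum.inr ⁻¹' μ))) v =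
        Sum.map (Quotient.mk (edgeConn ends (Sum.inl ⁻¹' μ)))
          (Quotient.mk (edgeConn ends' (Sum.inr ⁻¹' μ))) w := by
      rintro (e | e) he v hv w hw
      · obtain ⟨a, ha, rfl⟩ := Sym2.mem_map.1 hv
        obtain ⟨b, hb, rfl⟩ := Sym2.mem_map.1 hw
        exact congrArg Sum.inl (Quotient.sound (edgeConn_mem (μ := Sum.inl ⁻¹' μ) he ha hb))
      · obtain ⟨a, ha, rfl⟩ := Sym2.mem_map.1 hv
        obtain ⟨b, hb, rfl⟩ := Sym2.mem_map.1 hw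
        exact congrArg Sum.inr (Quotient.sound (edgeConn_mem (μ := Sum.inr ⁻¹' μ) he ha hb))
    intro e he v w h
    exact key e he v (by rw [h]; simp) w (by rw [h]; simp)
  · have h1 : edgeConn ends (Sum.inl ⁻¹' μ) ≤ (edgeConn (sumEnds ends ends') μ).comap Sum.inl := by
      refine edgeConn_le fun e he v w h => ?_
      refine edgeConn_of (e := Sum.inl e) he ?_
      simp [sumEnds, h]
    have h2 : edgeConn ends' (Sum.inr ⁻¹' μ) ≤ (edgeConn (sumEnds ends ends') μ).comap Sum.inr := by
      refine edgeConn_le fun e he v w h => ?_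
      refine edgeConn_of (e := Sum.inr e) he ?_
      simp [sumEnds, h]
    rintro (v | v) (w | w) h
    · exact h1 (Quotient.exact (Sum.inl.inj h))
    · cases h
    · cases h
    · exact h2 (Quotient.exact (Sum.inr.inj h))

theorem sum_edgeConn_inl {V E W F : Type} {ends : E → Sym2 V} {ends' : F → Sym2 W}
    {μ : Set (E ⊕ F)} {v w : V} : edgeConn (sumEnds ends ends') μ (.inl v) (.inl w) ↔
      edgeConn ends (Sum.inl ⁻¹' μ) v w := by
  rw [sum_edgeConn]
  exact ⟨fun h => Quotient.exact (Sum.inl.inj h), fun h => congrArg Sum.inl (Quotient.sound h)⟩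

theorem sum_edgeConn_inr {V E W F : Type} {ends : E → Sym2 V} {ends' : F → Sym2 W}
    {μ : Set (E ⊕ F)} {v w : W} : edgeConn (sumEnds ends ends') μ (.inr v) (.inr w) ↔
      edgeConn ends' (Sum.inr ⁻¹' μ) v w := by
  rw [sum_edgeConn]
  exact ⟨fun h => Quotient.exact (Sum.inr.inj h), fun h => congrArg Sum.inr (Quotient.sound h)⟩

theorem sum_edgeConn_inl_inr {V E W F : Type} {ends : E → Sym2 V} {ends' : F → Sym2 W}
    {μ : Set (E ⊕ F)} {v : V} {w : W} : ¬ edgeConn (sumEnds ends ends') μ (.inl v) (.inr w) := by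
  rw [sum_edgeConn]
  intro h
  cases h

theorem sum_edgeConn_inr_inl {V E W F : Type} {ends : E → Sym2 V} {ends' : F → Sym2 W}
    {μ : Set (E ⊕ F)} {v : W} {w : V} : ¬ edgeConn (sumEnds ends ends') μ (.inr v) (.inl w) := by
  rw [sum_edgeConn]
  intro h
  cases h

theorem loopNumber_sum {V E W F : Type} [Finite V] [Finite E] [Finite W] [Finite F]
    (ends : E → Sym2 V) (ends' : F → Sym2 W) (μ : Set (E ⊕ F)) :
    loopNumber (sumEnds ends ends') μ =
      loopNumber ends (Sum.inl ⁻¹' μ) + loopNumber ends' (Sum.inr ⁻¹' μ) := by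
  have e1 : Nat.card (Quotient (edgeConn (sumEnds ends ends') μ)) =
      Nat.card (Quotient (edgeConn ends (Sum.inl ⁻¹' μ))) +
        Nat.card (Quotient (edgeConn ends' (Sum.inr ⁻¹' μ))) := by
    rw [← Nat.card_sum, sum_edgeConn]
    exact Nat.card_congr (Setoid.quotientKerEquivOfSurjective _
      (Sum.map_surjective.2 ⟨Quotient.mk_surjective, Quotient.mk_surjective⟩))
  have e2 : Nat.card μ = Nat.card (Sum.inl ⁻¹' μ : Set E) + Nat.card (Sum.inr ⁻¹' μ : Set F) := by
    rw [← Nat.card_sum]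
    exact Nat.card_congr (Equiv.subtypeSum)
  unfold loopNumber
  rw [e1, e2, Nat.card_sum]
  push_cast
  ring

universe u v

open Classical in
/-- A Feynman graph: a finite multigraph (self-loops allowed, not necessarily connected, possibly
empty) without isolated vertices, with edge masses, with external momenta in `P` (a vertex is
external if the total momentum entering there is nonzero), and with the mass dimensions of its
edges and vertices. In each connected component the momenta are conserved and non-exceptional:
only the empty and the full set of external vertices have total momentum zero. -/
structure FeynmanGraph (P : Type u) [AddCommGroup P] where
  V : Type
  E : Type
  [fintypeV : Fintype V]
  [fintypeE : Fintype E]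
  ends : E → Sym2 V
  mass : E → ℝ≥0
  mom : V → P
  edgeWeight : E → ℝ
  vertexWeight : V → ℝ
  no_isolated : ∀ v, ∃ e, v ∈ ends e
  conservation : ∀ v, ∑ w with edgeConn ends Set.univ v w, mom w = 0
  nonexceptional : ∀ s : Finset V, (∀ v ∈ s, ∀ w ∈ s, edgeConn ends Set.univ v w) →
    ∑ v ∈ s, mom v = 0 → ∀ v ∈ s, mom v ≠ 0 →
      ∀ w, edgeConn ends Set.univ v w → mom w ≠ 0 → w ∈ s

namespace FeynmanGraph

attribute [instance] FeynmanGraph.fintypeV FeynmanGraph.fintypeE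

variable {P : Type u} [AddCommGroup P]

/-- Vertices joined by a path. -/
abbrev Joined (G : FeynmanGraph P) (v w : G.V) : Prop := edgeConn G.ends Set.univ v w

/-- The connected components. -/
abbrev Component (G : FeynmanGraph P) : Type := Quotient (edgeConn G.ends Set.univ)

/-- The edges of a connected component. -/
def edgesOf (G : FeynmanGraph P) (c : G.Component) : Set G.E :=
  {e | ∀ v ∈ G.ends e, (Quotient.mk _ v : G.Component) = c}

/-- `γ` is mass-momentum-spanning in the connected component `c` of `G`: it contains all massive
edges of `c`, and one connected component of `γ` contains all external vertices of `c`. -/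
def MassMomentumSpanningAt (G : FeynmanGraph P) (γ : Set G.E) (c : G.Component) : Prop :=
  (∀ e ∈ G.edgesOf c, G.mass e ≠ 0 → e ∈ γ) ∧
  ∀ v w : G.V, (Quotient.mk _ v : G.Component) = c → (Quotient.mk _ w : G.Component) = c →
    G.mom v ≠ 0 → G.mom w ≠ 0 → edgeConn G.ends γ v w

/-- `γ` is mass-momentum-spanning in (every connected component of) `G`. -/
def MassMomentumSpanning (G : FeynmanGraph P) (γ : Set G.E) : Prop :=
  ∀ c, G.MassMomentumSpanningAt γ c

theorem joined_of_sub {G : FeynmanGraph P} {γ : Set G.E} {v w : SubV G.ends γ}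
    (h : edgeConn (subEnds G.ends γ) Set.univ v w) : G.Joined v.1 w.1 :=
  edgeConn_mono (Set.subset_univ _) (sub_edgeConn.1 h)

theorem sub_joined_iff {G : FeynmanGraph P} {γ : Set G.E} {v w : SubV G.ends γ} :
    edgeConn (subEnds G.ends γ) Set.univ v w ↔ edgeConn G.ends γ v.1 w.1 := by
  rw [sub_edgeConn, Set.image_univ, Subtype.range_coe]

theorem subV_of_edgeConn {G : FeynmanGraph P} {γ : Set G.E} {v : SubV G.ends γ} {w : G.V}
    (h : edgeConn G.ends γ v.1 w) : ∃ e ∈ γ, w ∈ G.ends e := by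
  let r : Setoid G.V := Setoid.comap (fun x => (∃ e ∈ γ, x ∈ G.ends e : Prop)) ⟨Eq, eq_equivalence⟩
  have : edgeConn G.ends γ ≤ r := by
    refine edgeConn_le fun e he v w hvw => ?_
    exact propext ⟨fun _ => ⟨e, he, by simp [hvw]⟩, fun _ => ⟨e, he, by simp [hvw]⟩⟩
  have h2 : (∃ e ∈ γ, v.1 ∈ G.ends e : Prop) = (∃ e ∈ γ, w ∈ G.ends e : Prop) := this h
  exact h2 ▸ v.2

open Classical in
/-- The subgraph with edge set `γ`. In each connected component of `G` it inherits the masses and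
external momenta if it is mass-momentum-spanning there, and neither of them otherwise. -/
noncomputable def sub (G : FeynmanGraph P) (γ : Set G.E) : FeynmanGraph P where
  V := SubV G.ends γ
  E := γ
  ends := subEnds G.ends γ
  mass e := if ∀ v ∈ G.ends e, G.MassMomentumSpanningAt γ (Quotient.mk _ v) then G.mass e else 0
  mom v := if G.MassMomentumSpanningAt γ (Quotient.mk _ v.1) then G.mom v.1 else 0
  edgeWeight e := G.edgeWeight e
  vertexWeight v := G.vertexWeight v.1
  no_isolated := by
    rintro ⟨v, e, he, hv⟩
    refine ⟨⟨e, he⟩, ?_⟩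
    rw [subEnds, Sym2.attachWith, Sym2.mem_pmap_iff]
    exact ⟨v, hv, rfl⟩
  conservation := by
    intro v
    by_cases hv : G.MassMomentumSpanningAt γ (Quotient.mk _ v.1)
    · by_cases hex : ∃ a, edgeConn G.ends γ v.1 a ∧ G.mom a ≠ 0
      · obtain ⟨a, ha, hma⟩ := hex
        have key := G.conservation v.1
        rw [← key]
        have hsub : (Finset.univ.filter fun w => edgeConn G.ends γ v.1 w) ⊆
            Finset.univ.filter fun w => edgeConn G.ends Set.univ v.1 w := by
          intro w
          simp only [Finset.mem_filter, Finset.mem_univ, true_and]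
          exact fun h => edgeConn_mono (Set.subset_univ _) h
        rw [← Finset.sum_subset hsub]
        · refine Finset.sum_bij (fun w _ => w.1) ?_ ?_ ?_ ?_
          · intro w hw
            simp only [Finset.mem_filter, Finset.mem_univ, true_and] at hw ⊢
            exact sub_joined_iff.1 hw
          · intro a _ b _ h
            exact Subtype.ext h
          · intro w hw
            simp only [Finset.mem_filter, Finset.mem_univ, true_and] at hw
            exact ⟨⟨w, subV_of_edgeConn hw⟩, by simpa using sub_joined_iff.2 hw, rfl⟩
          · intro w hw
            simp only [Finset.mem_filter, Finset.mem_univ, true_and] at hw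
            have : (Quotient.mk _ w.1 : G.Component) = Quotient.mk _ v.1 :=
              (Quotient.sound (joined_of_sub hw)).symm
            rw [this, if_pos hv]
        · intro w hw hw'
          simp only [Finset.mem_filter, Finset.mem_univ, true_and] at hw hw'
          by_contra hne
          refine hw' ((edgeConn G.ends γ).trans' ha (hv.2 a w ?_ ?_ hma hne))
          · exact (Quotient.sound (edgeConn_mono (Set.subset_univ _) ha)).symm
          · exact (Quotient.sound hw).symm
      · push Not at hex
        refine Finset.sum_eq_zero fun w hw => ?_
        simp only [Finset.mem_filter, Finset.mem_univ, true_and] at hw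
        rw [hex w.1 (sub_joined_iff.1 hw), ite_self]
    · refine Finset.sum_eq_zero fun w hw => ?_
      simp only [Finset.mem_filter, Finset.mem_univ, true_and] at hw
      have : (Quotient.mk _ w.1 : G.Component) = Quotient.mk _ v.1 :=
        (Quotient.sound (joined_of_sub hw)).symm
      rw [this, if_neg hv]
  nonexceptional := by
    intro s hs hsum v hv hmv w hvw hmw
    have hmm : G.MassMomentumSpanningAt γ (Quotient.mk _ v.1) := by
      by_contra h; exact hmv (if_neg h)
    have hmom : ∀ x : SubV G.ends γ, G.Joined v.1 x.1 →
        (if G.MassMomentumSpanningAt γ (Quotient.mk _ x.1) then G.mom x.1 else 0) = G.mom x.1 := by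
      intro x hx
      have : (Quotient.mk _ x.1 : G.Component) = Quotient.mk _ v.1 := (Quotient.sound hx).symm
      rw [this, if_pos hmm]
    have hmem : w.1 ∈ s.map ⟨Subtype.val, Subtype.val_injective⟩ := by
      refine G.nonexceptional _ ?_ ?_ v.1 ?_ ?_ w.1 (joined_of_sub hvw) ?_
      · intro a ha b hb
        obtain ⟨a, ha', rfl⟩ := Finset.mem_map.1 ha
        obtain ⟨b, hb', rfl⟩ := Finset.mem_map.1 hb
        exact joined_of_sub (hs a ha' b hb')
      · rw [Finset.sum_map, ← hsum]
        exact Finset.sum_congr rfl fun x hx => (hmom x (joined_of_sub (hs v hv x hx))).symm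
      · exact Finset.mem_map.2 ⟨v, hv, rfl⟩
      · rw [← hmom v ((edgeConn _ _).refl' _)]; exact hmv
      · rw [← hmom w (joined_of_sub hvw)]; exact hmw
    obtain ⟨x, hx, hxw⟩ := Finset.mem_map.1 hmem
    exact (Subtype.ext hxw : x = w) ▸ hx

theorem joined_of_quot {G : FeynmanGraph P} {γ : Set G.E} {v w : G.V}
    {hv : ∃ e ∉ γ, Quotient.mk _ v ∈ (G.ends e).map (Quotient.mk (edgeConn G.ends γ))}
    {hw : ∃ e ∉ γ, Quotient.mk _ w ∈ (G.ends e).map (Quotient.mk (edgeConn G.ends γ))}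
    {μ : Set (γᶜ : Set G.E)} :
    edgeConn (quotEnds G.ends γ) μ ⟨Quotient.mk _ v, hv⟩ ⟨Quotient.mk _ w, hw⟩ ↔
      edgeConn G.ends (liftSet γ μ) v w := by
  rw [← quotMap_eq_iff]
  unfold quotMap
  rw [dif_pos hv, dif_pos hw]
  exact ⟨fun h => congrArg _ (Quotient.sound h), fun h => Quotient.exact (Sum.inl.inj h)⟩

theorem liftSet_univ {E : Type} (γ : Set E) : liftSet γ Set.univ = Set.univ := by
  ext e; by_cases h : e ∈ γ <;> simp [liftSet, h]

theorem quot_joined_iff {G : FeynmanGraph P} {γ : Set G.E} {v w : G.V}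
    {hv : ∃ e ∉ γ, Quotient.mk _ v ∈ (G.ends e).map (Quotient.mk (edgeConn G.ends γ))}
    {hw : ∃ e ∉ γ, Quotient.mk _ w ∈ (G.ends e).map (Quotient.mk (edgeConn G.ends γ))} :
    edgeConn (quotEnds G.ends γ) Set.univ ⟨Quotient.mk _ v, hv⟩ ⟨Quotient.mk _ w, hw⟩ ↔
      G.Joined v w := by
  rw [joined_of_quot, liftSet_univ]

/-- A class of a joined vertex survives the contraction if the class of the first one does. -/
theorem quotV_of_joined {G : FeynmanGraph P} {γ : Set G.E} {v w : G.V}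
    (hv : ∃ e ∉ γ, Quotient.mk _ v ∈ (G.ends e).map (Quotient.mk (edgeConn G.ends γ)))
    (h : G.Joined v w) :
    ∃ e ∉ γ, Quotient.mk _ w ∈ (G.ends e).map (Quotient.mk (edgeConn G.ends γ)) := by
  replace h : edgeConn G.ends Set.univ v w := h
  rw [← liftSet_univ γ, ← quotMap_eq_iff] at h
  unfold quotMap at h
  rw [dif_pos hv] at h
  by_contra hw
  rw [dif_neg hw] at h
  cases h

open Classical in
/-- The contraction `G / γ`: every connected component of `γ` becomes a vertex, which carries the
total momentum and has weight `0`. -/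
noncomputable def quot (G : FeynmanGraph P) (γ : Set G.E) : FeynmanGraph P where
  V := QuotV G.ends γ
  E := (γᶜ : Set G.E)
  ends := quotEnds G.ends γ
  mass e := G.mass e
  mom c := ∑ v with Quotient.mk _ v = c.1, G.mom v
  edgeWeight e := G.edgeWeight e
  vertexWeight c := ∑ v with Quotient.mk _ v = c.1 ∧ ¬ ∃ e ∈ γ, v ∈ G.ends e, G.vertexWeight v
  no_isolated := by
    rintro ⟨c, e, he, hc⟩
    refine ⟨⟨e, he⟩, ?_⟩
    rw [quotEnds, Sym2.attachWith, Sym2.mem_pmap_iff]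
    exact ⟨c, hc, rfl⟩
  conservation := by
    rintro ⟨c, hc⟩
    obtain ⟨v, rfl⟩ := Quotient.exists_rep c
    rw [← G.conservation v, Finset.sum_sigma']
    refine Finset.sum_bij (fun x _ => x.2) ?_ ?_ ?_ ?_
    · rintro ⟨⟨d, hd⟩, w⟩ hw
      simp only [Finset.mem_sigma, Finset.mem_filter, Finset.mem_univ, true_and] at hw ⊢
      obtain ⟨h1, rfl⟩ := hw
      exact quot_joined_iff.1 h1
    · rintro ⟨⟨d, hd⟩, w⟩ hw ⟨⟨d', hd'⟩, w'⟩ hw' h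
      simp only [Finset.mem_sigma, Finset.mem_filter, Finset.mem_univ, true_and] at hw hw' h
      obtain ⟨h1, rfl⟩ := hw
      obtain ⟨h1', rfl⟩ := hw'
      subst h
      rfl
    · intro w hw
      simp only [Finset.mem_filter, Finset.mem_univ, true_and] at hw
      refine ⟨⟨⟨Quotient.mk _ w, quotV_of_joined hc hw⟩, w⟩, ?_, rfl⟩
      simp only [Finset.mem_sigma, Finset.mem_filter, Finset.mem_univ, true_and, and_true]
      exact quot_joined_iff.2 hw
    · intros; rfl
  nonexceptional := by
    rintro s hs hsum c hc hmc d hcd hmd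
    obtain ⟨v, hv, hmv⟩ := Finset.exists_ne_zero_of_sum_ne_zero hmc
    obtain ⟨w, hw, hmw⟩ := Finset.exists_ne_zero_of_sum_ne_zero hmd
    simp only [Finset.mem_filter, Finset.mem_univ, true_and] at hv hw
    obtain ⟨c, hc'⟩ := c
    obtain ⟨d, hd'⟩ := d
    simp only at hv hw
    subst hv hw
    have := G.nonexceptional
      (Finset.univ.filter fun x => ∃ h, (⟨Quotient.mk _ x, h⟩ : QuotV G.ends γ) ∈ s) ?_ ?_ v ?_
      hmv w (quot_joined_iff.1 hcd) hmw
    · simp only [Finset.mem_filter, Finset.mem_univ, true_and] at this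
      exact this.2
    · intro a ha b hb
      simp only [Finset.mem_filter, Finset.mem_univ, true_and] at ha hb
      obtain ⟨ha, ha'⟩ := ha
      obtain ⟨hb, hb'⟩ := hb
      exact quot_joined_iff.1 (hs _ ha' _ hb')
    · rw [← hsum, Finset.sum_sigma']
      symm
      refine Finset.sum_bij (fun x _ => x.2) ?_ ?_ ?_ ?_
      · rintro ⟨⟨d, hd⟩, w⟩ hw
        simp only [Finset.mem_sigma, Finset.mem_filter, Finset.mem_univ, true_and] at hw ⊢
        obtain ⟨h1, rfl⟩ := hw
        exact ⟨hd, h1⟩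
      · rintro ⟨⟨d, hd⟩, w⟩ hw ⟨⟨d', hd'⟩, w'⟩ hw' h
        simp only [Finset.mem_sigma, Finset.mem_filter, Finset.mem_univ, true_and] at hw hw' h
        obtain ⟨h1, rfl⟩ := hw
        obtain ⟨h1', rfl⟩ := hw'
        subst h
        rfl
      · intro w hw
        simp only [Finset.mem_filter, Finset.mem_univ, true_and] at hw
        obtain ⟨h1, h2⟩ := hw
        exact ⟨⟨⟨Quotient.mk _ w, h1⟩, w⟩, by simpa using h2, rfl⟩
      · intros; rfl
    · simp only [Finset.mem_filter, Finset.mem_univ, true_and]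
      exact ⟨hc', hc⟩

/-- Isomorphism of Feynman graphs. -/
structure Iso (G H : FeynmanGraph P) where
  toV : G.V ≃ H.V
  toE : G.E ≃ H.E
  ends_eq : ∀ e, H.ends (toE e) = (G.ends e).map toV
  mass_eq : ∀ e, H.mass (toE e) = G.mass e
  mom_eq : ∀ v, H.mom (toV v) = G.mom v
  edgeWeight_eq : ∀ e, H.edgeWeight (toE e) = G.edgeWeight e
  vertexWeight_eq : ∀ v, H.vertexWeight (toV v) = G.vertexWeight v

def Iso.refl (G : FeynmanGraph P) : Iso G G where
  toV := .refl _
  toE := .refl _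
  ends_eq _ := by simp
  mass_eq _ := rfl
  mom_eq _ := rfl
  edgeWeight_eq _ := rfl
  vertexWeight_eq _ := rfl

def Iso.symm {G H : FeynmanGraph P} (f : Iso G H) : Iso H G where
  toV := f.toV.symm
  toE := f.toE.symm
  ends_eq e := by
    have := f.ends_eq (f.toE.symm e)
    rw [Equiv.apply_symm_apply] at this
    rw [this, Sym2.map_map]
    simp
  mass_eq e := by simpa using (f.mass_eq (f.toE.symm e)).symm
  mom_eq v := by simpa using (f.mom_eq (f.toV.symm v)).symm
  edgeWeight_eq e := by simpa using (f.edgeWeight_eq (f.toE.symm e)).symm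
  vertexWeight_eq v := by simpa using (f.vertexWeight_eq (f.toV.symm v)).symm

def Iso.trans {G H J : FeynmanGraph P} (f : Iso G H) (g : Iso H J) : Iso G J where
  toV := f.toV.trans g.toV
  toE := f.toE.trans g.toE
  ends_eq e := by simp [f.ends_eq, g.ends_eq, Sym2.map_map]
  mass_eq e := by simp [f.mass_eq, g.mass_eq]
  mom_eq v := by simp [f.mom_eq, g.mom_eq]
  edgeWeight_eq e := by simp [f.edgeWeight_eq, g.edgeWeight_eq]
  vertexWeight_eq v := by simp [f.vertexWeight_eq, g.vertexWeight_eq]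

/-- The empty graph. -/
def empty (P : Type u) [AddCommGroup P] : FeynmanGraph P where
  V := Empty
  E := Empty
  ends := Empty.elim
  mass := Empty.elim
  mom := Empty.elim
  edgeWeight := Empty.elim
  vertexWeight := Empty.elim
  no_isolated v := v.elim
  conservation v := v.elim
  nonexceptional _ _ _ v := v.elim

/-- The disjoint union of two graphs. -/
def disjUnion (G H : FeynmanGraph P) : FeynmanGraph P where
  V := G.V ⊕ H.V
  E := G.E ⊕ H.E
  ends := sumEnds G.ends H.ends
  mass := Sum.elim G.mass H.mass
  mom := Sum.elim G.mom H.mom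
  edgeWeight := Sum.elim G.edgeWeight H.edgeWeight
  vertexWeight := Sum.elim G.vertexWeight H.vertexWeight
  no_isolated := by
    rintro (v | v)
    · obtain ⟨e, he⟩ := G.no_isolated v
      exact ⟨.inl e, Sym2.mem_map.2 ⟨v, he, rfl⟩⟩
    · obtain ⟨e, he⟩ := H.no_isolated v
      exact ⟨.inr e, Sym2.mem_map.2 ⟨v, he, rfl⟩⟩
  conservation := by
    classical
    rintro (v | v)
    · rw [Finset.sum_filter, Fintype.sum_sum_type]
      simp only [sum_edgeConn_inl, sum_edgeConn_inl_inr, Sum.elim_inl, if_false,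
        Finset.sum_const_zero, add_zero]
      rw [← Finset.sum_filter]
      convert G.conservation v using 4
      rw [Set.preimage_univ]
    · rw [Finset.sum_filter, Fintype.sum_sum_type]
      simp only [sum_edgeConn_inr, sum_edgeConn_inr_inl, Sum.elim_inr, if_false,
        Finset.sum_const_zero, zero_add]
      rw [← Finset.sum_filter]
      convert H.conservation v using 4
      rw [Set.preimage_univ]
  nonexceptional := by
    classical
    intro s hs hsum v hv hmv w hvw hmw
    rcases v with v | v <;> rcases w with w | w
    · have h0 : s.toRight = ∅ := by
        refine Finset.eq_empty_of_forall_notMem fun x hx => ?_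
        exact sum_edgeConn_inl_inr (hs _ hv _ (Finset.mem_toRight.1 hx))
      have h := G.nonexceptional s.toLeft ?_ ?_ v (Finset.mem_toLeft.2 hv) hmv w
        (sum_edgeConn_inl.1 hvw) hmw
      · exact Finset.mem_toLeft.1 h
      · intro a ha b hb
        exact sum_edgeConn_inl.1 (hs _ (Finset.mem_toLeft.1 ha) _ (Finset.mem_toLeft.1 hb))
      · rw [← hsum, Finset.sum_sum_eq_sum_toLeft_add_sum_toRight, h0]
        simp
    · exact (sum_edgeConn_inl_inr hvw).elim
    · exact (sum_edgeConn_inr_inl hvw).elim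
    · have h0 : s.toLeft = ∅ := by
        refine Finset.eq_empty_of_forall_notMem fun x hx => ?_
        exact sum_edgeConn_inr_inl (hs _ hv _ (Finset.mem_toLeft.1 hx))
      have h := H.nonexceptional s.toRight ?_ ?_ v (Finset.mem_toRight.2 hv) hmv w
        (sum_edgeConn_inr.1 hvw) hmw
      · exact Finset.mem_toRight.1 h
      · intro a ha b hb
        exact sum_edgeConn_inr.1 (hs _ (Finset.mem_toRight.1 ha) _ (Finset.mem_toRight.1 hb))
      · rw [← hsum, Finset.sum_sum_eq_sum_toLeft_add_sum_toRight, h0]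
        simp

def Iso.disjUnion {G G' H H' : FeynmanGraph P} (f : Iso G G') (g : Iso H H') :
    Iso (G.disjUnion H) (G'.disjUnion H') where
  toV := f.toV.sumCongr g.toV
  toE := f.toE.sumCongr g.toE
  ends_eq := by
    rintro (e | e)
    · refine (congrArg (Sym2.map Sum.inl) (f.ends_eq e)).trans ?_
      change _ = Sym2.map _ (Sym2.map Sum.inl (G.ends e))
      cases G.ends e
      rfl
    · refine (congrArg (Sym2.map Sum.inr) (g.ends_eq e)).trans ?_
      change _ = Sym2.map _ (Sym2.map Sum.inr (H.ends e))
      cases H.ends e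
      rfl
  mass_eq := by rintro (e | e); exacts [f.mass_eq e, g.mass_eq e]
  mom_eq := by rintro (v | v); exacts [f.mom_eq v, g.mom_eq v]
  edgeWeight_eq := by rintro (e | e); exacts [f.edgeWeight_eq e, g.edgeWeight_eq e]
  vertexWeight_eq := by rintro (v | v); exacts [f.vertexWeight_eq v, g.vertexWeight_eq v]

def Iso.comm (G H : FeynmanGraph P) : Iso (G.disjUnion H) (H.disjUnion G) where
  toV := .sumComm _ _
  toE := .sumComm _ _
  ends_eq := by
    rintro (e | e)
    · change Sym2.map Sum.inr (G.ends e) = Sym2.map _ (Sym2.map Sum.inl (G.ends e))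
      cases G.ends e
      rfl
    · change Sym2.map Sum.inl (H.ends e) = Sym2.map _ (Sym2.map Sum.inr (H.ends e))
      cases H.ends e
      rfl
  mass_eq := by rintro (e | e) <;> rfl
  mom_eq := by rintro (e | e) <;> rfl
  edgeWeight_eq := by rintro (e | e) <;> rfl
  vertexWeight_eq := by rintro (e | e) <;> rfl

def Iso.assoc (G H J : FeynmanGraph P) :
    Iso ((G.disjUnion H).disjUnion J) (G.disjUnion (H.disjUnion J)) where
  toV := .sumAssoc _ _ _
  toE := .sumAssoc _ _ _
  ends_eq := by
    rintro ((e | e) | e)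
    · change Sym2.map Sum.inl (G.ends e) =
        Sym2.map _ (Sym2.map Sum.inl (Sym2.map Sum.inl (G.ends e)))
      cases G.ends e
      rfl
    · change Sym2.map Sum.inr (Sym2.map Sum.inl (H.ends e)) =
        Sym2.map _ (Sym2.map Sum.inl (Sym2.map Sum.inr (H.ends e)))
      cases H.ends e
      rfl
    · change Sym2.map Sum.inr (Sym2.map Sum.inr (J.ends e)) =
        Sym2.map _ (Sym2.map Sum.inr (J.ends e))
      cases J.ends e
      rfl
  mass_eq := by rintro ((e | e) | e) <;> rfl
  mom_eq := by rintro ((e | e) | e) <;> rfl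
  edgeWeight_eq := by rintro ((e | e) | e) <;> rfl
  vertexWeight_eq := by rintro ((e | e) | e) <;> rfl

def Iso.emptyUnion (G : FeynmanGraph P) : Iso ((empty P).disjUnion G) G where
  toV := Equiv.emptySum Empty G.V
  toE := Equiv.emptySum Empty G.E
  ends_eq := by
    rintro (e | e)
    · exact e.elim
    · change G.ends e = Sym2.map _ (Sym2.map Sum.inr (G.ends e))
      cases G.ends e
      rfl
  mass_eq := by rintro (e | e); exacts [e.elim, rfl]
  mom_eq := by rintro (e | e); exacts [e.elim, rfl]
  edgeWeight_eq := by rintro (e | e); exacts [e.elim, rfl]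
  vertexWeight_eq := by rintro (e | e); exacts [e.elim, rfl]

/-- The number of loops of the subgraph with edge set `γ`. -/
noncomputable def loops (G : FeynmanGraph P) (γ : Set G.E) : ℤ := loopNumber G.ends γ

/-- `G` is motic: every proper mass-momentum-spanning subgraph has strictly fewer loops. -/
def IsMotic (G : FeynmanGraph P) : Prop :=
  ∀ μ : Set G.E, μ ≠ Set.univ → G.MassMomentumSpanning μ → G.loops μ < G.loops Set.univ

theorem massMomentumSpanning_iff {G : FeynmanGraph P} {γ : Set G.E} :
    G.MassMomentumSpanning γ ↔ (∀ e, G.mass e ≠ 0 → e ∈ γ) ∧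
      ∀ v w, G.Joined v w → G.mom v ≠ 0 → G.mom w ≠ 0 → edgeConn G.ends γ v w := by
  constructor
  · intro h
    refine ⟨fun e he => ?_, fun v w hvw hv hw => ?_⟩
    · obtain ⟨v, hv⟩ : ∃ v, v ∈ G.ends e := ⟨_, Sym2.out_fst_mem _⟩
      exact (h (Quotient.mk _ v)).1 e
        (fun w hw => Quotient.sound (edgeConn_mem (Set.mem_univ e) hw hv)) he
    · exact (h (Quotient.mk _ v)).2 v w rfl (Quotient.sound hvw).symm hv hw
  · rintro ⟨h1, h2⟩ c
    exact ⟨fun e _ he => h1 e he,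
      fun v w hv hw hv' hw' => h2 v w (Quotient.exact (hv.trans hw.symm)) hv' hw'⟩

theorem isMotic_empty : (empty P).IsMotic :=
  fun _ hμ => (hμ (Set.ext fun e => (e : Empty).elim)).elim

theorem IsMotic.disjUnion {G H : FeynmanGraph P} (hG : G.IsMotic) (hH : H.IsMotic) :
    (G.disjUnion H).IsMotic := by
  intro μ hμ hmm
  rw [massMomentumSpanning_iff] at hmm
  have h1 : G.MassMomentumSpanning (Sum.inl ⁻¹' μ) := massMomentumSpanning_iff.2
    ⟨fun e he => hmm.1 (.inl e) he, fun v w hvw hv hw =>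
      sum_edgeConn_inl.1 (hmm.2 (.inl v) (.inl w) (sum_edgeConn_inl.2 hvw) hv hw)⟩
  have h2 : H.MassMomentumSpanning (Sum.inr ⁻¹' μ) := massMomentumSpanning_iff.2
    ⟨fun e he => hmm.1 (.inr e) he, fun v w hvw hv hw =>
      sum_edgeConn_inr.1 (hmm.2 (.inr v) (.inr w) (sum_edgeConn_inr.2 hvw) hv hw)⟩
  have e1 : (G.disjUnion H).loops μ = G.loops (Sum.inl ⁻¹' μ) + H.loops (Sum.inr ⁻¹' μ) :=
    loopNumber_sum _ _ _
  have e2 : (G.disjUnion H).loops Set.univ = G.loops Set.univ + H.loops Set.univ :=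
    loopNumber_sum _ _ _
  rw [e1, e2]
  by_cases c1 : (Sum.inl ⁻¹' μ : Set G.E) = Set.univ <;>
    by_cases c2 : (Sum.inr ⁻¹' μ : Set H.E) = Set.univ
  · refine (hμ (Set.eq_univ_of_forall ?_)).elim
    rintro (e | e)
    · exact c1.ge (Set.mem_univ e)
    · exact c2.ge (Set.mem_univ e)
  · rw [c1]
    have := hH _ c2 h2
    lia
  · rw [c2]
    have := hG _ c1 h1
    lia
  · have := hG _ c1 h1
    have := hH _ c2 h2
    lia

theorem IsMotic.quot {G : FeynmanGraph P} (hG : G.IsMotic) (γ : Set G.E) :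
    (G.quot γ).IsMotic := by
  classical
  intro μ hμ hmm
  rw [massMomentumSpanning_iff] at hmm
  have e1 : (G.quot γ).loops μ = G.loops (liftSet γ μ) - G.loops γ := loopNumber_quot _ _ _
  have e2 : (G.quot γ).loops Set.univ = G.loops Set.univ - G.loops γ := by
    rw [← liftSet_univ γ]; exact loopNumber_quot _ _ _
  rw [e1, e2]
  refine sub_lt_sub_right (hG _ ?_ (massMomentumSpanning_iff.2 ⟨?_, ?_⟩)) _
  · intro h
    refine hμ (Set.eq_univ_of_forall fun e => ?_)
    have he : e.1 ∈ liftSet γ μ := h ▸ Set.mem_univ _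
    rcases he with he | ⟨e', he', hee⟩
    · exact (e.2 he).elim
    · exact (Subtype.ext hee : e' = e) ▸ he'
  · intro e he
    by_cases heγ : e ∈ γ
    · exact Or.inl heγ
    · exact Or.inr ⟨⟨e, heγ⟩, hmm.1 ⟨e, heγ⟩ he, rfl⟩
  · intro v w hvw hv hw
    by_cases hc : edgeConn G.ends γ v w
    · exact edgeConn_mono Set.subset_union_left hc
    have key : ∀ a b, G.Joined a b → G.mom a ≠ 0 → G.mom b ≠ 0 → ¬ edgeConn G.ends γ a b →
        ∑ x with Quotient.mk (edgeConn G.ends γ) x = Quotient.mk _ a, G.mom x ≠ 0 := by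
      intro a b hab ha hb hnc h0
      have := G.nonexceptional _ ?_ h0 a (by simp) ha b hab hb
      · simp only [Finset.mem_filter, Finset.mem_univ, true_and] at this
        exact hnc (Quotient.exact this.symm)
      · intro x hx y hy
        simp only [Finset.mem_filter, Finset.mem_univ, true_and] at hx hy
        exact edgeConn_mono (Set.subset_univ _) (Quotient.exact (hx.trans hy.symm))
    have hv' : ∃ e ∉ γ, Quotient.mk _ v ∈ (G.ends e).map (Quotient.mk (edgeConn G.ends γ)) := by
      by_contra hcon
      have hvw' : edgeConn G.ends Set.univ v w := hvw
      rw [← liftSet_univ γ, ← quotMap_eq_iff] at hvw'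
      unfold quotMap at hvw'
      rw [dif_neg hcon] at hvw'
      split_ifs at hvw' with h'
      exact hc (Quotient.exact (congrArg Subtype.val (Sum.inr.inj hvw')))
    have hw' := quotV_of_joined hv' hvw
    refine joined_of_quot.1 (hmm.2 ⟨_, hv'⟩ ⟨_, hw'⟩ (quot_joined_iff.2 hvw) ?_ ?_)
    · exact key v w hvw hv hw hc
    · exact key w v ((edgeConn _ _).symm' hvw) hw hv fun h => hc ((edgeConn _ _).symm' h)

/-- `G` is scaleless: it depends neither on external momenta nor on masses. -/
def IsScaleless (G : FeynmanGraph P) : Prop := (∀ v, G.mom v = 0) ∧ ∀ e, G.mass e = 0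

/-- The superficial degree of divergence in spacetime dimension `D`. -/
noncomputable def omega (D : ℕ) (G : FeynmanGraph P) : ℝ :=
  D * G.loops Set.univ + ∑ v, G.vertexWeight v - ∑ e, G.edgeWeight e

/-- A connected component as a graph of its own. -/
noncomputable def component (G : FeynmanGraph P) (c : G.Component) : FeynmanGraph P :=
  G.sub (G.edgesOf c)

/-- One-particle-irreducible: connected, also after the removal of any one edge. -/
def IsOnePI (G : FeynmanGraph P) : Prop :=
  (∀ v w, G.Joined v w) ∧ ∀ (e : G.E) (v w : G.V), edgeConn G.ends {e}ᶜ v w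

/-- All connected components are 1PI and superficially UV divergent. -/
def IsUVDivergent (D : ℕ) (G : FeynmanGraph P) : Prop :=
  ∀ c, (G.component c).IsOnePI ∧ 0 ≤ (G.component c).omega D

/-- `G` is scaleless and all connected components are superficially IR divergent. -/
def IsIRDivergent (D : ℕ) (G : FeynmanGraph P) : Prop :=
  G.IsScaleless ∧ ∀ c, (G.component c).omega D ≤ 0

/-- All connected components have superficial degree of divergence zero. -/
def IsLogDivergent (D : ℕ) (G : FeynmanGraph P) : Prop :=
  ∀ c, (G.component c).omega D = 0

/-- Every divergent motic subgraph is logarithmically divergent. -/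
def HasOnlyLogSubdivergences (D : ℕ) (G : FeynmanGraph P) : Prop :=
  ∀ γ : Set G.E, (G.sub γ).IsMotic → (G.sub γ).IsUVDivergent D → (G.sub γ).IsLogDivergent D

end FeynmanGraph

open FeynmanGraph

/-- Motic graphs. -/
abbrev MoticGraph (P : Type u) [AddCommGroup P] := {G : FeynmanGraph P // G.IsMotic}

section MoticAlgebra

variable {P : Type u} [AddCommGroup P]

instance moticSetoid (P : Type u) [AddCommGroup P] : Setoid (MoticGraph P) where
  r G H := Nonempty (Iso G.1 H.1)
  iseqv := ⟨fun G => ⟨Iso.refl G.1⟩, fun ⟨f⟩ => ⟨f.symm⟩, fun ⟨f⟩ ⟨g⟩ => ⟨f.trans g⟩⟩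

/-- Isomorphism classes of motic graphs. -/
def MoticClass (P : Type u) [AddCommGroup P] := Quotient (moticSetoid P)

def MoticClass.mk (G : MoticGraph P) : MoticClass P := Quotient.mk _ G

/-- A representative. -/
noncomputable def MoticClass.rep (x : MoticClass P) : MoticGraph P := Quotient.out x

/-- The number of edges. -/
noncomputable def MoticClass.numEdges : MoticClass P → ℕ :=
  Quotient.lift (fun G => Fintype.card G.1.E) fun _ _ ⟨f⟩ => Fintype.card_congr f.toE

/-- Classes of motic graphs form a commutative monoid under disjoint union. -/
instance : CommMonoid (MoticClass P) where
  mul := Quotient.map₂ (fun G H => ⟨G.1.disjUnion H.1, G.2.disjUnion H.2⟩)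
    fun _ _ ⟨f⟩ _ _ ⟨g⟩ => ⟨f.disjUnion g⟩
  one := MoticClass.mk ⟨empty P, isMotic_empty⟩
  mul_assoc := by
    rintro ⟨G⟩ ⟨H⟩ ⟨J⟩
    exact Quotient.sound ⟨Iso.assoc G.1 H.1 J.1⟩
  mul_comm := by
    rintro ⟨G⟩ ⟨H⟩
    exact Quotient.sound ⟨Iso.comm G.1 H.1⟩
  one_mul := by
    rintro ⟨G⟩
    exact Quotient.sound ⟨Iso.emptyUnion G.1⟩
  mul_one := by
    rintro ⟨G⟩
    exact Quotient.sound ⟨(Iso.comm G.1 (empty P)).trans (Iso.emptyUnion G.1)⟩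

/-- The algebra `𝓜`: the `ℚ`-vector space spanned by the motic graphs up to isomorphism, with
disjoint union as product and the empty graph as unit. -/
abbrev MoticAlgebra (P : Type u) [AddCommGroup P] := MonoidAlgebra ℚ (MoticClass P)

/-- A class as an element of the algebra. -/
noncomputable abbrev MoticClass.toAlg (x : MoticClass P) : MoticAlgebra P := MonoidAlgebra.of ℚ _ x

/-- A motic graph as an element of the algebra. -/
noncomputable def graphElem (G : MoticGraph P) : MoticAlgebra P := (MoticClass.mk G).toAlg

/-- Linear extension of a map given on graphs. -/
noncomputable def extendLinear {N : Type*} [AddCommGroup N] [Module ℚ N] (f : MoticClass P → N) :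
    MoticAlgebra P →ₗ[ℚ] N :=
  (MonoidAlgebra.basis (MoticClass P) ℚ).constr ℚ f

/-- The motic subgraphs. -/
abbrev MoticSub (G : MoticGraph P) := {γ : Set G.1.E // (G.1.sub γ).IsMotic}

noncomputable instance (G : MoticGraph P) : Fintype (MoticSub G) := Fintype.ofFinite _

/-- The class of a motic subgraph. -/
noncomputable def MoticSub.subClass {G : MoticGraph P} (γ : MoticSub G) : MoticClass P :=
  MoticClass.mk ⟨G.1.sub γ.1, γ.2⟩

/-- The class of the contracted graph. -/
noncomputable def MoticSub.quotClass {G : MoticGraph P} (γ : MoticSub G) : MoticClass P :=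
  MoticClass.mk ⟨G.1.quot γ.1, G.2.quot γ.1⟩

/-- The coproduct `Γ ↦ ∑ γ ⊗ Γ / γ`, summed over the motic subgraphs. -/
noncomputable def coproduct : MoticAlgebra P →ₗ[ℚ] MoticAlgebra P ⊗[ℚ] MoticAlgebra P :=
  extendLinear fun x => ∑ γ : MoticSub x.rep, γ.subClass.toAlg ⊗ₜ[ℚ] γ.quotClass.toAlg

/-- The double coproduct `(Δ ⊗ id) ∘ Δ`. -/
noncomputable def coproduct₂ :
    MoticAlgebra P →ₗ[ℚ] (MoticAlgebra P ⊗[ℚ] MoticAlgebra P) ⊗[ℚ] MoticAlgebra P :=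
  TensorProduct.map coproduct LinearMap.id ∘ₗ coproduct

theorem MoticSub.numEdges_lt {x : MoticClass P} (γ : MoticSub x.rep) (h : γ.1 ≠ Set.univ) :
    γ.subClass.numEdges < x.numEdges := by
  have e : x.numEdges = Fintype.card x.rep.1.E := by
    conv_lhs => rw [← Quotient.out_eq x]
    rfl
  rw [e]
  obtain ⟨a, ha⟩ := (Set.ne_univ_iff_exists_notMem _).1 h
  exact Fintype.card_lt_of_injective_of_notMem (Subtype.val : γ.1 → x.rep.1.E)
    Subtype.val_injective (b := a) (by rintro ⟨b, rfl⟩; exact ha b.2)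

open Classical in
/-- The antipode on graphs: `S(𝕀) = 𝕀` and, for `Γ ≠ 𝕀`,
`S(Γ) = -Γ - ∑ S(γ) Γ / γ`, summed over the motic subgraphs `∅ ≠ γ ≠ Γ`. -/
noncomputable def antipodeClass (x : MoticClass P) : MoticAlgebra P :=
  if x = 1 then 1 else
    -x.toAlg - ∑ γ : {γ : MoticSub x.rep // γ.1 ≠ ∅ ∧ γ.1 ≠ Set.univ},
      antipodeClass γ.1.subClass * γ.1.quotClass.toAlg
termination_by x.numEdges
decreasing_by exact γ.1.numEdges_lt γ.2.2

/-- The antipode of the motic Hopf algebra. -/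
noncomputable def antipode : MoticAlgebra P →ₗ[ℚ] MoticAlgebra P := extendLinear antipodeClass

open Classical in
/-- The projection onto the span of the graphs with UV divergent 1PI components. -/
noncomputable def rhoUV (D : ℕ) : MoticAlgebra P →ₗ[ℚ] MoticAlgebra P :=
  extendLinear fun x =>
    if ∃ G : MoticGraph P, MoticClass.mk G = x ∧ G.1.IsUVDivergent D then x.toAlg else 0

open Classical in
/-- The projection onto the span of the scaleless graphs with IR divergent components. -/
noncomputable def rhoIR (D : ℕ) : MoticAlgebra P →ₗ[ℚ] MoticAlgebra P :=
  extendLinear fun x =>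
    if ∃ G : MoticGraph P, MoticClass.mk G = x ∧ G.1.IsIRDivergent D then x.toAlg else 0

variable {A : Type v} [CommRing A] [Algebra ℚ A]

/-- The map `m ∘ (f ⊗ g ⊗ h)` into `A`. -/
noncomputable def tripleProduct (f g h : MoticAlgebra P →ₗ[ℚ] A) :
    (MoticAlgebra P ⊗[ℚ] MoticAlgebra P) ⊗[ℚ] MoticAlgebra P →ₗ[ℚ] A :=
  LinearMap.mul' ℚ A ∘ₗ TensorProduct.map (LinearMap.mul' ℚ A) LinearMap.id ∘ₗ
    TensorProduct.map (TensorProduct.map f g) h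

/-- `K` is a projection onto "divergent parts": an additive (hence `ℚ`-linear) idempotent map such
that products of divergent parts are again divergent parts. -/
structure IsSubtractionScheme {A : Type v} [CommRing A] (K : A →+ A) : Prop where
  idem : ∀ a, K (K a) = K a
  mul : ∀ a b, K (K a * K b) = K a * K b

/-- Minimal subtraction: the projection of a Laurent series onto its pole part. -/
noncomputable def minimalSubtraction : LaurentSeries ℂ →+ LaurentSeries ℂ :=
  (HahnSeries.truncLTLinearMap ℂ (0 : ℤ)).toAddMonoidHom

theorem isSubtractionScheme_minimalSubtraction :
    IsSubtractionScheme minimalSubtraction where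
  idem a := by
    ext n
    change (if n < 0 then (if n < 0 then a.coeff n else 0) else 0) = if n < 0 then a.coeff n else 0
    split_ifs <;> rfl
  mul a b := by
    ext n
    change (if n < 0 then (HahnSeries.truncLT 0 a * HahnSeries.truncLT 0 b).coeff n else 0) =
      (HahnSeries.truncLT 0 a * HahnSeries.truncLT 0 b).coeff n
    split_ifs with h
    · rfl
    · rw [HahnSeries.coeff_mul]
      refine (Finset.sum_eq_zero ?_).symm
      rintro ⟨i, j⟩ hij
      rw [Finset.mem_antidiagonal] at hij
      obtain ⟨hi, hj, hij⟩ := hij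
      rw [HahnSeries.support_truncLT] at hi hj
      have h1 := hi.2
      have h2 := hj.2
      simp only at h1 h2 hij
      lia

/-- The UV counterterm map `Z` and the IR counterterm map `Z'` for the Feynman rules `φ` and the
subtraction `K`: unital multiplicative linear maps that satisfy, on all graphs but the empty one,
`Z  = -K ∘ m ∘ (Z ⊗ φ ⊗ Z') ∘ (Δ⁽²⁾ - id ⊗ 𝕀 ⊗ 𝕀) ∘ ρ_UV` and
`Z' = -K ∘ m ∘ (Z ⊗ φ ⊗ Z') ∘ (Δ⁽²⁾ - 𝕀 ⊗ 𝕀 ⊗ id) ∘ ρ_IR`. -/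
structure IsCountertermPair (D : ℕ) (K : A →+ A) (φ : MoticAlgebra P →ₗ[ℚ] A)
    (Z Z' : MoticAlgebra P →ₐ[ℚ] A) : Prop where
  uv : ∀ x : MoticClass P, x ≠ 1 →
    Z x.toAlg = -K (tripleProduct Z.toLinearMap φ Z'.toLinearMap
      (coproduct₂ (rhoUV D x.toAlg) - (rhoUV D x.toAlg ⊗ₜ[ℚ] 1) ⊗ₜ[ℚ] 1))
  ir : ∀ x : MoticClass P, x ≠ 1 →
    Z' x.toAlg = -K (tripleProduct Z.toLinearMap φ Z'.toLinearMap
      (coproduct₂ (rhoIR D x.toAlg) - (1 ⊗ₜ[ℚ] 1) ⊗ₜ[ℚ] rhoIR D x.toAlg))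

end MoticAlgebra

/-! A scaleless graph has no masses and no external vertices, so all its edge sets are
mass-momentum-spanning. Motic then means that deleting any edge lowers the loop number, that is,
that no edge is a bridge (`IsScaleless.isMotic_iff`). Everything below takes place in the finite
poset of bridgeless edge sets of the fixed graph `G`, and a pair `a ⊆ b` stands for the graph `b /
a`.

A map `f` on graphs gives a triangular matrix with entries `f(b / a)`. The motic subgraphs of `b /
a` are the `c / a` with `c` bridgeless between `a` and `b`, with quotient `b / c`, so convolution
along the coproduct becomes matrix multiplication (`IsScaleless.intervalMatrix_mul`). The
isomorphisms this needs come from one uniqueness statement: two graphs that present the same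
interval are isomorphic (`IntervalPresentation.nonempty_iso`). The recursion for `S` says that the
matrix of `F ∘ S` is inverse to that of `F`, for every algebra homomorphism `F`
(`intervalMatrix_antipode_mul`).

It would thus suffice that the matrices of `Z` and `Z'` are inverse to each other. This is shown
only where it is needed. On a non-empty log-divergent scaleless graph `x` the Feynman rules remove
all middle factors but the trivial one, so the UV recursion reads `Z(x) = -K(Z'(x) + proper terms)`.
The proper terms are products of values in the image of `K`, hence fixed by `K`, as is `Z'(x)`; so
the convolution of `Z` and `Z'` vanishes at `x` (`IsCountertermPair.moticConv_eq_zero`).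

If `a` and `b` are logarithmic, so is `b / a`, because degrees of divergence add under contraction
(`localOmega_eq_add`). The intermediate sets that contribute are logarithmic too. If `Z(c / a) ≠ 0`
and `a` is logarithmic, then `c` has nonnegative degrees, hence zero ones, as there are only
log-subdivergences. If `Z'(b / c) ≠ 0` and `b` is logarithmic, then the degrees of `b / c` and of
`c` are nonpositive and add up to zero. Substitution in the triangular systems therefore stays among
logarithmic sets (`ir_eq_uv_antipode`, `uv_eq_ir_antipode`); the theorem is the entry at `∅` and the
full edge set. -/

section Connectivity

/-! ### Connectivity, bridges and loop numbers of edge sets. -/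

variable {V E : Type} {ends : E → Sym2 V}

/-- A vertex is covered by an edge set if it is an end of one of its edges. -/
def IsCovered (ends : E → Sym2 V) (γ : Set E) (v : V) : Prop := ∃ e ∈ γ, v ∈ ends e

/-- This serves as induction along a path. With values in `Prop`, the invariant is a property of
vertices that each edge preserves in both directions. -/
theorem edgeConn_of_apply_eq {X : Type*} {γ : Set E} (f : V → X)
    (h : ∀ e ∈ γ, ∀ v w, ends e = s(v, w) → f v = f w) {v w : V} (hvw : edgeConn ends γ v w) :
    f v = f w :=
  (edgeConn_le (r := Setoid.ker f) h) hvw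

theorem eq_of_edgeConn_of_not_isCovered {γ : Set E} {v w : V} (h : edgeConn ends γ v w)
    (hv : ¬ IsCovered ends γ v) : v = w := by
  have key : (v = v) = (v = w) := by
    refine edgeConn_of_apply_eq (fun u => v = u) (fun e he p q hpq => ?_) h
    have hp : v ≠ p := by rintro rfl; exact hv ⟨e, he, by simp [hpq]⟩
    have hq : v ≠ q := by rintro rfl; exact hv ⟨e, he, by simp [hpq]⟩
    simp [hp, hq]
  exact key.mp rfl

theorem IsCovered.of_edgeConn {γ : Set E} {v w : V} (hv : IsCovered ends γ v)
    (h : edgeConn ends γ v w) : IsCovered ends γ w := by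
  by_contra hw
  exact hw (eq_of_edgeConn_of_not_isCovered ((edgeConn ends γ).symm' h) hw ▸ hv)

/-- Connectivity in `s` only depends on the edges of `s` near the given vertex. -/
theorem edgeConn_of_forall_mem {s t : Set E} {v w : V}
    (h : ∀ e ∈ s, ∀ u ∈ ends e, edgeConn ends s v u → e ∈ t) (hvw : edgeConn ends s v w) :
    edgeConn ends t v w := by
  -- Connectivity in `s` is carried along in the invariant because the hypothesis applies only to
  -- edges that `s` joins to `v`.
  have key : (edgeConn ends s v v ∧ edgeConn ends t v v) =
      (edgeConn ends s v w ∧ edgeConn ends t v w) := by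
    refine edgeConn_of_apply_eq (fun u => edgeConn ends s v u ∧ edgeConn ends t v u)
      (fun e he p q hpq => ?_) hvw
    have hs : edgeConn ends s p q := edgeConn_of he hpq
    refine propext ⟨fun ⟨h1, h2⟩ => ?_, fun ⟨h1, h2⟩ => ?_⟩
    · have ht := edgeConn_of (h e he p (by simp [hpq]) h1) hpq
      exact ⟨(edgeConn ends s).trans' h1 hs, (edgeConn ends t).trans' h2 ht⟩
    · have ht := edgeConn_of (h e he q (by simp [hpq]) h1) hpq
      exact ⟨(edgeConn ends s).trans' h1 ((edgeConn ends s).symm' hs),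
        (edgeConn ends t).trans' h2 ((edgeConn ends t).symm' ht)⟩
  exact (key.mp ⟨(edgeConn ends s).refl' v, (edgeConn ends t).refl' v⟩).2

theorem edgeConn_ends {γ : Set E} {e : E} (he : e ∈ γ) {v u w : V} (hu : u ∈ ends e)
    (h : edgeConn ends γ v u) (hw : w ∈ ends e) : edgeConn ends γ v w :=
  (edgeConn ends γ).trans' h (edgeConn_mem he hu hw)

/-- No edge of `γ` is a bridge of `γ`. -/
def Bridgeless (ends : E → Sym2 V) (γ : Set E) : Prop :=
  ∀ e ∈ γ, ∀ v w, ends e = s(v, w) → edgeConn ends (γ \ {e}) v w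

theorem bridgeless_empty : Bridgeless ends ∅ := fun _ he => he.elim

/-- Each passage of a path through `e` is replaced by the detour around it. -/
theorem Bridgeless.edgeConn_diff {γ : Set E} (h : Bridgeless ends γ) (e : E) {v w : V}
    (hvw : edgeConn ends γ v w) : edgeConn ends (γ \ {e}) v w := by
  refine edgeConn_le (r := edgeConn ends (γ \ {e})) (fun f hf p q hpq => ?_) hvw
  by_cases hfe : f = e
  · subst hfe; exact h f hf p q hpq
  · exact edgeConn_of (μ := γ \ {e}) ⟨hf, hfe⟩ hpq

/-- The hypothesis makes `t` a union of connected components of `s`, and a detour around an edge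
never leaves its component. -/
theorem Bridgeless.of_forall_mem {s t : Set E} (hs : Bridgeless ends s) (hts : t ⊆ s)
    (h : ∀ e ∈ t, ∀ u ∈ ends e, ∀ f ∈ s, ∀ w ∈ ends f, edgeConn ends s u w → f ∈ t) :
    Bridgeless ends t := by
  intro e he v w hvw
  refine edgeConn_of_forall_mem (fun f hf u hu hc => ⟨?_, hf.2⟩) (hs e (hts he) v w hvw)
  exact h e he v (by simp [hvw]) f hf.1 u hu (edgeConn_mono Set.sdiff_subset hc)

theorem card_quotient_le_insert [Finite V] (γ : Set E) (e : E) :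
    Nat.card (Quotient (edgeConn ends γ)) ≤
      Nat.card (Quotient (edgeConn ends (insert e γ))) + 1 := by
  classical
  obtain ⟨p, q, hpq⟩ : ∃ p q, ends e = s(p, q) := by
    induction h : ends e using Sym2.ind with | _ p q => exact ⟨p, q, rfl⟩
  -- Redirecting the class of `q` to that of `p` makes `f` constant along `e` as well, and hence on
  -- the classes of `insert e γ`.
  let f : V → Quotient (edgeConn ends γ) := fun u =>
    if edgeConn ends γ u q then Quotient.mk _ p else Quotient.mk _ u
  have hf : ∀ v w, edgeConn ends (insert e γ) v w → f v = f w := by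
    intro v w
    refine edgeConn_of_apply_eq f fun e' he' a b hab => ?_
    rcases he' with rfl | he'
    · have hq : edgeConn ends γ q q := (edgeConn ends γ).refl' q
      have key : f p = f q := by
        simp only [f, hq, if_true]; split_ifs <;> rfl
      rcases Sym2.eq_iff.1 (hpq.symm.trans hab) with ⟨rfl, rfl⟩ | ⟨rfl, rfl⟩
      exacts [key, key.symm]
    · have hc : edgeConn ends γ a b := edgeConn_of he' hab
      have : edgeConn ends γ a q ↔ edgeConn ends γ b q :=
        ⟨(edgeConn ends γ).trans' ((edgeConn ends γ).symm' hc), (edgeConn ends γ).trans' hc⟩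
      simp only [f, this]
      split_ifs
      · rfl
      · exact Quotient.sound hc
  -- Inserting `e` can merge only the class of `q` with another one. Sending it to `none` leaves an
  -- injective map, and `none` accounts for the `+ 1`.
  let g : Quotient (edgeConn ends γ) → Option (Quotient (edgeConn ends (insert e γ))) := fun c =>
    if c = Quotient.mk _ q then none
    else some (Quotient.map' id (fun _ _ h => edgeConn_mono (Set.subset_insert e γ) h) c)
  have hg : Function.Injective g := by
    intro c d hcd
    simp only [g] at hcd
    split_ifs at hcd with h1 h2 h2
    · rw [h1, h2]
    · induction c using Quotient.ind with | _ c => ?_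
      induction d using Quotient.ind with | _ d => ?_
      have h := hf c d (Quotient.exact (Option.some.inj hcd))
      have h1' : ¬ edgeConn ends γ c q := fun h => h1 (Quotient.sound h)
      have h2' : ¬ edgeConn ends γ d q := fun h => h2 (Quotient.sound h)
      simpa only [f, if_neg h1', if_neg h2'] using h
  have := Nat.card_le_card_of_injective g hg
  rwa [Finite.card_option] at this

theorem loopNumber_le_insert [Finite V] [Finite E] {γ : Set E} {e : E} (he : e ∉ γ) :
    loopNumber ends γ ≤ loopNumber ends (insert e γ) := by
  have h1 := card_quotient_le_insert (ends := ends) γ e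
  have h2 : Nat.card ↥(insert e γ) = Nat.card γ + 1 := by
    rw [Nat.card_coe_set_eq, Nat.card_coe_set_eq, Set.ncard_insert_of_notMem he]
  unfold loopNumber
  rw [h2]
  push_cast
  lia

theorem loopNumber_mono [Finite V] [Finite E] {γ δ : Set E} (h : γ ⊆ δ) :
    loopNumber ends γ ≤ loopNumber ends δ := by
  have key : ∀ s : Set E, loopNumber ends γ ≤ loopNumber ends (γ ∪ s) := by
    intro s
    induction s, s.toFinite using Set.Finite.induction_on with
    | empty => simp
    | @insert e s _ _ ih =>
      by_cases he : e ∈ γ ∪ s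
      · rwa [Set.union_insert, Set.insert_eq_of_mem he]
      · rw [Set.union_insert]
        exact ih.trans (loopNumber_le_insert he)
  have := key δ
  rwa [Set.union_eq_self_of_subset_left h] at this

/-- Without `e` there is one edge less, so the loop number drops exactly when the number of
components does not rise. The components of the complement map onto those of the whole; equal finite
cardinalities make this map injective. -/
theorem loopNumber_compl_singleton_lt_iff [Finite V] [Finite E] (e : E) :
    loopNumber ends {e}ᶜ < loopNumber ends Set.univ ↔
      edgeConn ends Set.univ ≤ edgeConn ends {e}ᶜ := by
  have hcard : Nat.card (Set.univ : Set E) = Nat.card ↥({e}ᶜ : Set E) + 1 := by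
    rw [Nat.card_coe_set_eq, Nat.card_coe_set_eq, Set.ncard_univ, add_comm,
      ← Set.ncard_singleton e, Set.ncard_add_ncard_compl]
  have hle : edgeConn ends {e}ᶜ ≤ edgeConn ends Set.univ := edgeConn_mono (Set.subset_univ _)
  unfold loopNumber
  rw [hcard]
  constructor
  · intro h
    have hlt : Nat.card (Quotient (edgeConn ends {e}ᶜ)) ≤
        Nat.card (Quotient (edgeConn ends (Set.univ : Set E))) := by
      push_cast at h
      lia
    let g : Quotient (edgeConn ends {e}ᶜ) → Quotient (edgeConn ends (Set.univ : Set E)) :=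
      Quotient.map' id fun _ _ h => hle h
    have hg : Function.Surjective g := by
      intro c
      induction c using Quotient.ind with | _ c => exact ⟨Quotient.mk _ c, rfl⟩
    have heq := le_antisymm hlt (Nat.card_le_card_of_surjective g hg)
    have hbij := (Nat.bijective_iff_surjective_and_card g).2 ⟨hg, heq⟩
    intro v w hvw
    exact Quotient.exact (hbij.1 (a₁ := Quotient.mk _ v) (a₂ := Quotient.mk _ w)
      (Quotient.sound hvw))
  · intro h
    rw [le_antisymm hle h]
    push_cast
    lia

end Connectivity

/-! ### Scaleless graphs: motic means bridgeless. -/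

namespace FeynmanGraph

variable {P : Type u} [AddCommGroup P]

theorem IsScaleless.massMomentumSpanning {G : FeynmanGraph P} (h : G.IsScaleless)
    (γ : Set G.E) : G.MassMomentumSpanning γ :=
  massMomentumSpanning_iff.2 ⟨fun e he => (he (h.2 e)).elim, fun v _ _ hv => (hv (h.1 v)).elim⟩

/-- Since loop numbers are monotone and the spanning condition is void, it is enough to test the
complements of single edges. -/
theorem IsScaleless.isMotic_iff {G : FeynmanGraph P} (h : G.IsScaleless) :
    G.IsMotic ↔ Bridgeless G.ends Set.univ := by
  constructor
  · intro hG e _ v w hvw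
    have hlt := hG {e}ᶜ (by simp) (h.massMomentumSpanning _)
    have := (loopNumber_compl_singleton_lt_iff e).1 hlt (edgeConn_of (Set.mem_univ e) hvw)
    rwa [Set.compl_eq_univ_sdiff] at this
  · intro hG μ hμ _
    obtain ⟨e, he⟩ := (Set.ne_univ_iff_exists_notMem _).1 hμ
    refine (loopNumber_mono (Set.subset_compl_singleton_iff.2 he)).trans_lt
      ((loopNumber_compl_singleton_lt_iff e).2 fun v w hvw => ?_)
    rw [Set.compl_eq_univ_sdiff]
    exact hG.edgeConn_diff e hvw

theorem IsScaleless.sub {G : FeynmanGraph P} (h : G.IsScaleless) (γ : Set G.E) :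
    (G.sub γ).IsScaleless := by
  classical
  constructor
  · intro v
    change (if _ then G.mom v.1 else 0) = 0
    rw [h.1, ite_self]
  · intro e
    change (if _ then G.mass e.1 else 0) = 0
    rw [h.2, ite_self]

theorem IsScaleless.quot {G : FeynmanGraph P} (h : G.IsScaleless) (γ : Set G.E) :
    (G.quot γ).IsScaleless :=
  ⟨fun _ => Finset.sum_eq_zero fun v _ => h.1 v, fun e => h.2 e.1⟩

theorem IsScaleless.of_iso {G H : FeynmanGraph P} (h : G.IsScaleless) (f : Iso G H) :
    H.IsScaleless := by
  constructor
  · intro v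
    rw [← f.toV.apply_symm_apply v, f.mom_eq, h.1]
  · intro e
    rw [← f.toE.apply_symm_apply e, f.mass_eq, h.2]

theorem bridgeless_subEnds_univ {V E : Type} {ends : E → Sym2 V} {γ : Set E} :
    Bridgeless (subEnds ends γ) Set.univ ↔ Bridgeless ends γ := by
  have key : ∀ e : γ, Subtype.val '' ((Set.univ : Set γ) \ {e}) = γ \ {e.1} := by
    intro e
    rw [Set.image_sdiff Subtype.val_injective, Set.image_univ, Subtype.range_coe,
      Set.image_singleton]
  constructor
  · intro h e he v w hvw
    have := h ⟨e, he⟩ (Set.mem_univ _) ⟨v, e, he, by simp [hvw]⟩ ⟨w, e, he, by simp [hvw]⟩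
      (subEnds_eq_iff.2 hvw)
    rwa [sub_edgeConn, key] at this
  · intro h e _ v w hvw
    rw [sub_edgeConn, key]
    exact h e e.2 _ _ (subEnds_eq_iff.1 hvw)

theorem IsScaleless.isMotic_sub_iff {G : FeynmanGraph P} (h : G.IsScaleless) {γ : Set G.E} :
    (G.sub γ).IsMotic ↔ Bridgeless G.ends γ :=
  (h.sub γ).isMotic_iff.trans bridgeless_subEnds_univ

theorem mem_edgesOf_iff {G : FeynmanGraph P} {x : G.V} {e : G.E} :
    e ∈ G.edgesOf (Quotient.mk _ x) ↔ ∀ u ∈ G.ends e, G.Joined x u :=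
  forall₂_congr fun _ _ => eq_comm.trans Quotient.eq

theorem mem_edgesOf_of_mem {G : FeynmanGraph P} {x u : G.V} {e : G.E} (hu : u ∈ G.ends e)
    (h : G.Joined x u) : e ∈ G.edgesOf (Quotient.mk _ x) :=
  mem_edgesOf_iff.2 fun _ hw => edgeConn_ends (Set.mem_univ e) hu h hw

/-- Detours around an edge stay in its component. So the 1PI clause in `IsUVDivergent` is automatic
for scaleless motic graphs, and only the sign of the degree remains. -/
theorem IsScaleless.component_isOnePI {G : FeynmanGraph P} (h : G.IsScaleless)
    (hG : G.IsMotic) (c : G.Component) : (G.component c).IsOnePI := by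
  induction c using Quotient.ind with | _ x => ?_
  have hb := h.isMotic_iff.1 hG
  have hx : ∀ v : SubV G.ends (G.edgesOf (Quotient.mk _ x)), G.Joined x v.1 := by
    rintro ⟨v, e, he, hv⟩
    exact mem_edgesOf_iff.1 he v hv
  have hvw : ∀ v w : SubV G.ends (G.edgesOf (Quotient.mk _ x)), G.Joined v.1 w.1 := fun v w =>
    (edgeConn _ _).trans' ((edgeConn _ _).symm' (hx v)) (hx w)
  constructor
  · intro v w
    refine sub_joined_iff.2 (edgeConn_of_forall_mem (fun e _ u hu hc => ?_) (hvw v w))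
    exact mem_edgesOf_of_mem hu ((edgeConn _ _).trans' (hx v) hc)
  · intro e v w
    refine sub_edgeConn.2 (edgeConn_of_forall_mem (s := Set.univ \ {e.1}) (fun f hf u hu hc => ?_)
      (hb.edgeConn_diff e.1 (hvw v w)))
    refine ⟨⟨f, mem_edgesOf_of_mem hu ((edgeConn _ _).trans' (hx v)
      (edgeConn_mono (Set.subset_univ _) hc))⟩, fun hfe => hf.2 ?_, rfl⟩
    exact congrArg Subtype.val hfe

end FeynmanGraph

/-! ### Presentations of the graphs `b / a`. -/

namespace FeynmanGraph

variable {P : Type u} [AddCommGroup P]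

open Classical in
/-- A presentation of the scaleless graph `H` as the graph `b / a`, for edge sets `a ⊆ b` of `G`:
the edges of `H` are those of `b \ a`, and a vertex of `H` is related to vertices of `G` that are
joined by `a`. -/
structure IntervalPresentation (G H : FeynmanGraph P) (a b : Set G.E) where
  edge : H.E → G.E
  rel : G.V → H.V → Prop
  subset : a ⊆ b
  edge_injective : Function.Injective edge
  range_edge : Set.range edge = b \ a
  eq_iff : ∀ {v w x y}, rel v x → rel w y → (x = y ↔ edgeConn G.ends a v w)
  exists_ends : ∀ e v w, G.ends (edge e) = s(v, w) → ∃ x y, rel v x ∧ rel w y ∧ H.ends e = s(x, y)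
  scaleless : H.IsScaleless
  edgeWeight_eq : ∀ e, H.edgeWeight e = G.edgeWeight (edge e)
  vertexWeight_eq : ∀ {v x}, rel v x →
    H.vertexWeight x = if IsCovered G.ends a v then 0 else G.vertexWeight v

namespace IntervalPresentation

variable {G H H' : FeynmanGraph P} {a b : Set G.E} (R : IntervalPresentation G H a b)

theorem exists_rel_of_mem {e : H.E} {x : H.V} (hx : x ∈ H.ends e) :
    ∃ v ∈ G.ends (R.edge e), R.rel v x := by
  obtain ⟨v, w, hvw⟩ : ∃ v w, G.ends (R.edge e) = s(v, w) := by
    induction h : G.ends (R.edge e) using Sym2.ind with | _ p q => exact ⟨p, q, rfl⟩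
  obtain ⟨y, z, hy, hz, h⟩ := R.exists_ends e v w hvw
  rw [h, Sym2.mem_iff] at hx
  rcases hx with rfl | rfl
  · exact ⟨v, by simp [hvw], hy⟩
  · exact ⟨w, by simp [hvw], hz⟩

theorem exists_rel (x : H.V) : ∃ v, R.rel v x := by
  obtain ⟨e, he⟩ := H.no_isolated x
  obtain ⟨v, -, hv⟩ := R.exists_rel_of_mem he
  exact ⟨v, hv⟩

theorem exists_rel_of_mem_ends {e : H.E} {v : G.V} (hv : v ∈ G.ends (R.edge e)) :
    ∃ x ∈ H.ends e, R.rel v x := by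
  obtain ⟨w, hw⟩ := Sym2.mem_iff_exists.1 hv
  obtain ⟨x, y, hx, -, h⟩ := R.exists_ends e v w hw
  exact ⟨x, by simp [h], hx⟩

theorem edge_mem (e : H.E) : R.edge e ∈ b :=
  (R.range_edge.subset (Set.mem_range_self e)).1

theorem edge_notMem (e : H.E) : R.edge e ∉ a :=
  (R.range_edge.subset (Set.mem_range_self e)).2

theorem exists_edge_eq {e : G.E} (hb : e ∈ b) (ha : e ∉ a) : ∃ f, R.edge f = e :=
  R.range_edge.superset ⟨hb, ha⟩

/-- The edges of `G` between `a` and `b` that correspond to edges of `H`. -/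
def lift (μ : Set H.E) : Set G.E := a ∪ R.edge '' μ

theorem subset_lift (μ : Set H.E) : a ⊆ R.lift μ := Set.subset_union_left

theorem lift_subset (μ : Set H.E) : R.lift μ ⊆ b :=
  Set.union_subset R.subset (by rintro _ ⟨e, -, rfl⟩; exact R.edge_mem e)

theorem lift_univ : R.lift Set.univ = b := by
  rw [lift, Set.image_univ, R.range_edge, Set.union_sdiff_cancel R.subset]

theorem lift_empty : R.lift ∅ = a := by simp [lift]

theorem edge_mem_lift {μ : Set H.E} {e : H.E} : R.edge e ∈ R.lift μ ↔ e ∈ μ := by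
  constructor
  · rintro (h | ⟨f, hf, h⟩)
    · exact (R.edge_notMem e h).elim
    · exact R.edge_injective h ▸ hf
  · exact fun h => Or.inr ⟨e, h, rfl⟩

theorem lift_injective : Function.Injective R.lift := fun μ ν h => by
  ext e
  rw [← R.edge_mem_lift, h, R.edge_mem_lift]

theorem exists_lift_eq {c : Set G.E} (hac : a ⊆ c) (hcb : c ⊆ b) : ∃ μ, R.lift μ = c := by
  refine ⟨R.edge ⁻¹' c, subset_antisymm ?_ fun e he => ?_⟩
  · exact Set.union_subset hac (by rintro _ ⟨e, he, rfl⟩; exact he)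
  · by_cases hea : e ∈ a
    · exact Or.inl hea
    · obtain ⟨f, rfl⟩ := R.exists_edge_eq (hcb he) hea
      exact Or.inr ⟨f, he, rfl⟩

/-- A vertex is in the fiber of a vertex of `H` if it is joined by `a` to a related vertex. -/
def fiber (v : G.V) (x : H.V) : Prop := ∃ u, edgeConn G.ends a u v ∧ R.rel u x

theorem fiber_of_rel {v : G.V} {x : H.V} (h : R.rel v x) : R.fiber v x :=
  ⟨v, (edgeConn _ _).refl' v, h⟩

theorem fiber_eq_iff {v w : G.V} {x y : H.V} (h : R.fiber v x) (h' : R.fiber w y) :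
    x = y ↔ edgeConn G.ends a v w := by
  obtain ⟨v', hv, hx⟩ := h
  obtain ⟨w', hw, hy⟩ := h'
  rw [R.eq_iff hx hy]
  exact ⟨fun h => (edgeConn _ _).trans' ((edgeConn _ _).symm' hv) ((edgeConn _ _).trans' h hw),
    fun h => (edgeConn _ _).trans' hv ((edgeConn _ _).trans' h ((edgeConn _ _).symm' hw))⟩

theorem fiber_of_edgeConn {v w : G.V} {x : H.V} (h : R.fiber v x)
    (hvw : edgeConn G.ends a v w) : R.fiber w x := by
  obtain ⟨u, hu, hx⟩ := h
  exact ⟨u, (edgeConn _ _).trans' hu hvw, hx⟩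

theorem fiber_iff_of_edgeConn {v w : G.V} {x : H.V} (hvw : edgeConn G.ends a v w) :
    R.fiber v x ↔ R.fiber w x :=
  ⟨fun h => R.fiber_of_edgeConn h hvw,
    fun h => R.fiber_of_edgeConn h ((edgeConn _ _).symm' hvw)⟩

theorem edgeConn_lift_of_edgeConn {μ : Set H.E} {v w : G.V} {x y : H.V} (hx : R.fiber v x)
    (hy : R.fiber w y) (h : edgeConn H.ends μ x y) : edgeConn G.ends (R.lift μ) v w := by
  have ha : edgeConn G.ends a ≤ edgeConn G.ends (R.lift μ) := edgeConn_mono (R.subset_lift μ)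
  choose r hr using R.exists_rel
  have hfib : ∀ {v x}, R.fiber v x → edgeConn G.ends (R.lift μ) v (r x) := fun h =>
    ha ((R.fiber_eq_iff h (R.fiber_of_rel (hr _))).1 rfl)
  -- The invariant along `μ` is the `lift μ`-class of the chosen representative; two vertices in the
  -- same fiber differ only by a path in `a`.
  have key : (Quotient.mk (edgeConn G.ends (R.lift μ)) (r x)) = Quotient.mk _ (r y) := by
    refine edgeConn_of_apply_eq (fun z => (Quotient.mk (edgeConn G.ends (R.lift μ)) (r z)))
      (fun e he p q hpq => Quotient.sound ?_) h
    obtain ⟨p', hp', hpr⟩ := R.exists_rel_of_mem (e := e) (x := p) (by simp [hpq])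
    obtain ⟨q', hq', hqr⟩ := R.exists_rel_of_mem (e := e) (x := q) (by simp [hpq])
    have h1 := hfib (R.fiber_of_rel hpr)
    have h2 := hfib (R.fiber_of_rel hqr)
    have h3 := edgeConn_mem (μ := R.lift μ) (R.edge_mem_lift.2 he) hp' hq'
    exact (edgeConn _ _).trans' ((edgeConn _ _).symm' h1) ((edgeConn _ _).trans' h3 h2)
  exact (edgeConn _ _).trans' (hfib hx)
    ((edgeConn _ _).trans' (Quotient.exact key) ((edgeConn _ _).symm' (hfib hy)))

/-- A path in `lift μ` projects to `H`: an edge of `a` stays in its fiber, and an edge of `μ` moves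
to the adjacent vertex. The vertex over `w` is part of the conclusion because not every vertex of
`G` lies over one of `H`. -/
theorem exists_fiber_of_edgeConn_lift {μ : Set H.E} {v w : G.V} {x : H.V} (hx : R.fiber v x)
    (h : edgeConn G.ends (R.lift μ) v w) : ∃ y, R.fiber w y ∧ edgeConn H.ends μ x y := by
  have key : (∃ y, R.fiber v y ∧ edgeConn H.ends μ x y) =
      (∃ y, R.fiber w y ∧ edgeConn H.ends μ x y) := by
    refine edgeConn_of_apply_eq (fun z => ∃ y, R.fiber z y ∧ edgeConn H.ends μ x y)
      (fun e he p q hpq => ?_) h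
    rcases he with he | ⟨e, he, rfl⟩
    · exact propext (exists_congr fun y =>
        and_congr_left' (R.fiber_iff_of_edgeConn (edgeConn_of he hpq)))
    · obtain ⟨y, z, hy, hz, hyz⟩ := R.exists_ends e p q hpq
      have hc : edgeConn H.ends μ y z := edgeConn_of he hyz
      refine propext ⟨?_, ?_⟩
      · rintro ⟨y', hy', h'⟩
        obtain rfl : y' = y :=
          (R.fiber_eq_iff hy' (R.fiber_of_rel hy)).2 ((edgeConn _ _).refl' p)
        exact ⟨z, R.fiber_of_rel hz, (edgeConn _ _).trans' h' hc⟩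
      · rintro ⟨z', hz', h'⟩
        obtain rfl : z' = z :=
          (R.fiber_eq_iff hz' (R.fiber_of_rel hz)).2 ((edgeConn _ _).refl' q)
        exact ⟨y, R.fiber_of_rel hy, (edgeConn _ _).trans' h' ((edgeConn _ _).symm' hc)⟩
  exact key.mp ⟨x, hx, (edgeConn _ _).refl' x⟩

theorem edgeConn_iff {μ : Set H.E} {v w : G.V} {x y : H.V} (hx : R.fiber v x)
    (hy : R.fiber w y) : edgeConn H.ends μ x y ↔ edgeConn G.ends (R.lift μ) v w := by
  refine ⟨R.edgeConn_lift_of_edgeConn hx hy, fun h => ?_⟩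
  obtain ⟨z, hz, hxz⟩ := R.exists_fiber_of_edgeConn_lift hx h
  rwa [(R.fiber_eq_iff hy hz).2 ((edgeConn _ _).refl' w)]

theorem joined_iff {v w : G.V} {x y : H.V} (hx : R.fiber v x) (hy : R.fiber w y) :
    H.Joined x y ↔ edgeConn G.ends b v w := by
  rw [← R.lift_univ]
  exact R.edgeConn_iff hx hy

/-- Detours project to `H` and lift back to `G`. The edges of `a` are invisible in `H`, and their
detours inside `a` come from `ha`. -/
theorem bridgeless_iff (ha : Bridgeless G.ends a) {μ : Set H.E} :
    Bridgeless H.ends μ ↔ Bridgeless G.ends (R.lift μ) := by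
  have key : ∀ e : H.E, R.lift (μ \ {e}) = R.lift μ \ {R.edge e} := by
    intro e
    rw [lift, lift, Set.image_sdiff R.edge_injective, Set.image_singleton, Set.union_sdiff_distrib,
      Set.sdiff_singleton_eq_self (R.edge_notMem e)]
  constructor
  · rintro h e (he | ⟨e, he, rfl⟩) v w hvw
    · exact edgeConn_mono (Set.sdiff_subset_sdiff_left (R.subset_lift μ)) (ha e he v w hvw)
    · obtain ⟨x, y, hx, hy, hxy⟩ := R.exists_ends e v w hvw
      rw [← key]
      exact R.edgeConn_lift_of_edgeConn (R.fiber_of_rel hx) (R.fiber_of_rel hy) (h e he x y hxy)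
  · intro h e he x y hxy
    obtain ⟨v, hv, hx⟩ := R.exists_rel_of_mem (e := e) (x := x) (by simp [hxy])
    obtain ⟨w, hw, hy⟩ := R.exists_rel_of_mem (e := e) (x := y) (by simp [hxy])
    rw [R.edgeConn_iff (R.fiber_of_rel hx) (R.fiber_of_rel hy), key]
    exact h.edgeConn_diff _ (edgeConn_mem (R.edge_mem_lift.2 he) hv hw)

/-- Two graphs that present the same interval are isomorphic. -/
theorem nonempty_iso (R : IntervalPresentation G H a b) (R' : IntervalPresentation G H' a b) : Nonempty (Iso H H') := by
  classical
  have hE : ∀ e : H.E, ∃ e' : H'.E, R'.edge e' = R.edge e := fun e =>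
    R'.exists_edge_eq (R.edge_mem e) (R.edge_notMem e)
  have hE' : ∀ e' : H'.E, ∃ e : H.E, R.edge e = R'.edge e' := fun e =>
    R.exists_edge_eq (R'.edge_mem e) (R'.edge_notMem e)
  choose f hf using hE
  choose f' hf' using hE'
  let toE : H.E ≃ H'.E := ⟨f, f', fun e => R.edge_injective ((hf' _).trans (hf e)),
    fun e => R'.edge_injective ((hf _).trans (hf' e))⟩
  -- Vertices are matched if they are related to a common vertex of `G`, which is found at an end of
  -- a shared edge. The two `eq_iff` fields then make the matching well defined and bijective.
  have hV : ∀ x : H.V, ∃ x' : H'.V, ∃ v, R.rel v x ∧ R'.rel v x' := by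
    intro x
    obtain ⟨e, he⟩ := H.no_isolated x
    obtain ⟨v, hv, hx⟩ := R.exists_rel_of_mem he
    rw [← hf e] at hv
    obtain ⟨x', -, hx'⟩ := R'.exists_rel_of_mem_ends hv
    exact ⟨x', v, hx, hx'⟩
  have hV' : ∀ x' : H'.V, ∃ x : H.V, ∃ v, R.rel v x ∧ R'.rel v x' := by
    intro x'
    obtain ⟨e, he⟩ := H'.no_isolated x'
    obtain ⟨v, hv, hx⟩ := R'.exists_rel_of_mem he
    rw [← hf' e] at hv
    obtain ⟨x, -, hx'⟩ := R.exists_rel_of_mem_ends hv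
    exact ⟨x, v, hx', hx⟩
  choose g r hg hg' using hV
  choose g' r' hr hr' using hV'
  have huniq : ∀ {v x x'}, R.rel v x → R'.rel v x' → x' = g x := fun {v x x'} h h' =>
    (R'.eq_iff h' (hg' x)).2 ((R.eq_iff h (hg x)).1 rfl)
  have huniq' : ∀ {v x x'}, R.rel v x → R'.rel v x' → x = g' x' := fun {v x x'} h h' =>
    (R.eq_iff h (hr x')).2 ((R'.eq_iff h' (hr' x')).1 rfl)
  let toV : H.V ≃ H'.V := ⟨g, g', fun x => (huniq' (hg x) (hg' x)).symm,
    fun x => (huniq (hr x) (hr' x)).symm⟩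
  refine ⟨⟨toV, toE, fun e => ?_, fun e => ?_, fun v => ?_, fun e => ?_, fun v => ?_⟩⟩
  · obtain ⟨v, w, hvw⟩ : ∃ v w, G.ends (R.edge e) = s(v, w) := by
      induction h : G.ends (R.edge e) using Sym2.ind with | _ p q => exact ⟨p, q, rfl⟩
    obtain ⟨x, y, hx, hy, hxy⟩ := R.exists_ends e v w hvw
    obtain ⟨x', y', hx', hy', hxy'⟩ := R'.exists_ends (f e) v w (by rw [hf, hvw])
    change H'.ends (f e) = (H.ends e).map g
    rw [hxy, hxy', Sym2.map_mk, huniq hx hx', huniq hy hy']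
  · rw [R.scaleless.2, R'.scaleless.2]
  · rw [R.scaleless.1, R'.scaleless.1]
  · rw [R.edgeWeight_eq, R'.edgeWeight_eq]
    exact congrArg _ (hf e)
  · rw [R.vertexWeight_eq (hg v)]
    exact R'.vertexWeight_eq (hg' v)

/-- Transport of a presentation along an isomorphism. -/
def ofIso (f : Iso H H') : IntervalPresentation G H' a b where
  edge e := R.edge (f.toE.symm e)
  rel v x := R.rel v (f.toV.symm x)
  subset := R.subset
  edge_injective := R.edge_injective.comp f.toE.symm.injective
  range_edge := by
    rw [← R.range_edge]
    exact f.toE.symm.surjective.range_comp R.edge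
  eq_iff hx hy := f.toV.symm.injective.eq_iff.symm.trans (R.eq_iff hx hy)
  exists_ends e v w h := by
    obtain ⟨x, y, hx, hy, hxy⟩ := R.exists_ends _ v w h
    refine ⟨f.toV x, f.toV y, by simpa using hx, by simpa using hy, ?_⟩
    rw [← f.toE.apply_symm_apply e, f.ends_eq, hxy, Sym2.map_mk]
  scaleless := R.scaleless.of_iso f
  edgeWeight_eq e := by rw [← R.edgeWeight_eq, ← f.edgeWeight_eq, Equiv.apply_symm_apply]
  vertexWeight_eq {v x} h := by
    rw [← R.vertexWeight_eq h, ← f.vertexWeight_eq, Equiv.apply_symm_apply]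

/-- Subgraphs of an interval graph. -/
def sub (μ : Set H.E) : IntervalPresentation G (H.sub μ) a (R.lift μ) where
  edge := fun e : μ => R.edge e.1
  rel := fun v (x : SubV H.ends μ) => R.rel v x.1
  subset := R.subset_lift μ
  edge_injective := R.edge_injective.comp Subtype.val_injective
  range_edge := by
    ext e
    constructor
    · rintro ⟨⟨e, he⟩, rfl⟩
      exact ⟨R.edge_mem_lift.2 he, R.edge_notMem e⟩
    · rintro ⟨h | ⟨e, he, rfl⟩, h'⟩
      · exact (h' h).elim
      · exact ⟨⟨e, he⟩, rfl⟩
  eq_iff hx hy := Subtype.ext_iff.trans (R.eq_iff hx hy)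
  exists_ends := by
    rintro ⟨e, he⟩ v w h
    obtain ⟨x, y, hx, hy, hxy⟩ := R.exists_ends e v w h
    exact ⟨⟨x, e, he, by simp [hxy]⟩, ⟨y, e, he, by simp [hxy]⟩, hx, hy, subEnds_eq_iff.2 hxy⟩
  scaleless := R.scaleless.sub μ
  edgeWeight_eq e := R.edgeWeight_eq e.1
  vertexWeight_eq h := R.vertexWeight_eq h

theorem isCovered_lift_iff {μ : Set H.E} {v : G.V} {x : H.V} (hx : R.rel v x) :
    IsCovered G.ends (R.lift μ) v ↔ IsCovered G.ends a v ∨ IsCovered H.ends μ x := by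
  constructor
  · rintro ⟨e, he | ⟨e, he, rfl⟩, hv⟩
    · exact Or.inl ⟨e, he, hv⟩
    · obtain ⟨x', hx', h⟩ := R.exists_rel_of_mem_ends hv
      rw [(R.eq_iff hx h).2 ((edgeConn _ _).refl' v)]
      exact Or.inr ⟨e, he, hx'⟩
  · rintro (⟨e, he, hv⟩ | ⟨e, he, hex⟩)
    · exact ⟨e, Or.inl he, hv⟩
    -- The edge at `x` lifts to an edge at some `w` over `x`, not necessarily at `v`. But `a` joins
    -- `v` to `w`, so the two coincide if `a` does not cover `v`.
    · by_contra hcon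
      obtain ⟨w, hw, h⟩ := R.exists_rel_of_mem hex
      have hvw := (R.eq_iff hx h).1 rfl
      have ha : ¬ IsCovered G.ends a v := fun ⟨f, hf, hfv⟩ => hcon ⟨f, Or.inl hf, hfv⟩
      obtain rfl := eq_of_edgeConn_of_not_isCovered hvw ha
      exact hcon ⟨R.edge e, R.edge_mem_lift.2 he, hw⟩

-- The class of a covered vertex consists of covered vertices, so the sum is empty; the class of an
-- uncovered vertex is a singleton.
open Classical in
theorem quot_vertexWeight {γ : Set G.E} (v : G.V)
    (h : ∃ e ∉ γ, Quotient.mk _ v ∈ (G.ends e).map (Quotient.mk (edgeConn G.ends γ))) :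
    (G.quot γ).vertexWeight ⟨Quotient.mk _ v, h⟩ =
      if IsCovered G.ends γ v then 0 else G.vertexWeight v := by
  have key : (G.quot γ).vertexWeight ⟨Quotient.mk _ v, h⟩ =
      ∑ w with Quotient.mk _ w = Quotient.mk (edgeConn G.ends γ) v ∧ ¬ IsCovered G.ends γ w,
        G.vertexWeight w :=
    Finset.sum_congr (Finset.ext fun w => by simp only [Finset.mem_filter]; rfl) fun _ _ => rfl
  rw [key]
  split_ifs with hv
  · refine Finset.sum_eq_zero fun w hw => ?_
    simp only [Finset.mem_filter, Finset.mem_univ, true_and] at hw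
    exact (hw.2 (hv.of_edgeConn ((edgeConn _ _).symm' (Quotient.exact hw.1)))).elim
  · rw [Finset.sum_eq_single v]
    · intro w hw hwv
      simp only [Finset.mem_filter, Finset.mem_univ, true_and] at hw
      exact (hwv (eq_of_edgeConn_of_not_isCovered (Quotient.exact hw.1) hw.2)).elim
    · intro h
      simp only [Finset.mem_filter, Finset.mem_univ, true_and] at h
      exact (h hv).elim

/-- Quotients of an interval graph. -/
noncomputable def quot (μ : Set H.E) : IntervalPresentation G (H.quot μ) (R.lift μ) b where
  edge := fun e : (μᶜ : Set H.E) => R.edge e.1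
  rel := fun v (X : QuotV H.ends μ) => ∃ x, R.rel v x ∧ Quotient.mk _ x = X.1
  subset := R.lift_subset μ
  edge_injective := R.edge_injective.comp Subtype.val_injective
  range_edge := by
    ext e
    constructor
    · rintro ⟨⟨e, he⟩, rfl⟩
      exact ⟨R.edge_mem e, fun h => he (R.edge_mem_lift.1 h)⟩
    · rintro ⟨h, h'⟩
      obtain ⟨e, rfl⟩ := R.exists_edge_eq h fun h => h' (R.subset_lift μ h)
      exact ⟨⟨e, fun h => h' (R.edge_mem_lift.2 h)⟩, rfl⟩
  eq_iff := by
    rintro v w ⟨_, _⟩ ⟨_, _⟩ ⟨x, hx, rfl⟩ ⟨y, hy, rfl⟩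
    rw [← R.edgeConn_iff (R.fiber_of_rel hx) (R.fiber_of_rel hy)]
    exact Subtype.ext_iff.trans Quotient.eq
  exists_ends := by
    rintro ⟨e, he⟩ v w h
    obtain ⟨x, y, hx, hy, hxy⟩ := R.exists_ends e v w h
    exact ⟨⟨Quotient.mk _ x, e, he, by simp [hxy]⟩, ⟨Quotient.mk _ y, e, he, by simp [hxy]⟩,
      ⟨x, hx, rfl⟩, ⟨y, hy, rfl⟩, quotEnds_eq_iff.2 (by simp [hxy])⟩
  scaleless := R.scaleless.quot μ
  edgeWeight_eq e := R.edgeWeight_eq e.1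
  vertexWeight_eq := by
    rintro v ⟨_, h⟩ ⟨x, hx, rfl⟩
    rw [quot_vertexWeight, R.vertexWeight_eq hx, R.isCovered_lift_iff hx]
    split_ifs with h1 h2 h3 <;> simp_all

theorem edgeConn_empty_iff {V E : Type} {ends : E → Sym2 V} {v w : V} :
    edgeConn ends ∅ v w ↔ v = w := by
  constructor
  · intro h
    exact eq_of_edgeConn_of_not_isCovered h fun ⟨e, he, _⟩ => he
  · rintro rfl
    exact (edgeConn ends ∅).refl' v

/-- A scaleless graph presents the full interval of its edge sets. -/
def self (hG : G.IsScaleless) : IntervalPresentation G G ∅ Set.univ where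
  edge := id
  rel := Eq
  subset := Set.subset_univ _
  edge_injective := Function.injective_id
  range_edge := by simp
  eq_iff := by
    rintro v w _ _ rfl rfl
    exact edgeConn_empty_iff.symm
  exists_ends e v w h := ⟨v, w, rfl, rfl, h⟩
  scaleless := hG
  edgeWeight_eq _ := rfl
  vertexWeight_eq := by
    rintro v _ rfl
    exact (if_neg fun ⟨e, he, _⟩ => he).symm

end IntervalPresentation

end FeynmanGraph

/-! ### Degrees of divergence under contraction. -/

namespace FeynmanGraph

variable {P : Type u} [AddCommGroup P]

open Classical in
/-- The superficial degree of divergence of the connected component at `v` of the spanning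
subgraph of `G` with edge set `γ`. -/
noncomputable def localOmega (G : FeynmanGraph P) (D : ℕ) (γ : Set G.E) (v : G.V) : ℝ :=
  D + ∑ u with edgeConn G.ends γ v u, (G.vertexWeight u - D) +
    ∑ e with e ∈ γ ∧ ∀ u ∈ G.ends e, edgeConn G.ends γ v u, (D - G.edgeWeight e)

open Classical in
theorem localOmega_univ (G : FeynmanGraph P) (D : ℕ) (v : G.V) :
    G.localOmega D Set.univ v = D + ∑ u with G.Joined v u, (G.vertexWeight u - D) +
      ∑ e with ∀ u ∈ G.ends e, G.Joined v u, (D - G.edgeWeight e) := by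
  unfold localOmega
  congr 1
  refine Finset.sum_congr (Finset.ext fun e => ?_) fun _ _ => rfl
  simp

theorem localOmega_congr {G : FeynmanGraph P} {γ δ : Set G.E} {v w : G.V} (D : ℕ)
    (h : ∀ u, edgeConn G.ends γ v u ↔ edgeConn G.ends δ w u)
    (h' : ∀ e, ∀ u ∈ G.ends e, edgeConn G.ends γ v u → (e ∈ γ ↔ e ∈ δ)) :
    G.localOmega D γ v = G.localOmega D δ w := by
  classical
  unfold localOmega
  congr 1
  · congr 1
    exact Finset.sum_congr (Finset.filter_congr fun u _ => h u) fun _ _ => rfl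
  · refine Finset.sum_congr (Finset.filter_congr fun e _ => ?_) fun _ _ => rfl
    obtain ⟨u, hu⟩ : ∃ u, u ∈ G.ends e := ⟨_, Sym2.out_fst_mem _⟩
    simp only [← h]
    exact and_congr_left fun hc => h' e u hu (hc u hu)

theorem localOmega_of_edgeConn {G : FeynmanGraph P} {γ : Set G.E} {v w : G.V} (D : ℕ)
    (h : edgeConn G.ends γ v w) : G.localOmega D γ v = G.localOmega D γ w :=
  localOmega_congr D (fun _ => ⟨(edgeConn _ _).trans' ((edgeConn _ _).symm' h),
    (edgeConn _ _).trans' h⟩) fun _ _ _ _ => Iff.rfl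

/-- The local degree of divergence only depends on the edges near the vertex. -/
theorem localOmega_of_forall_mem {G : FeynmanGraph P} {s t : Set G.E} (hts : t ⊆ s) {v : G.V}
    (D : ℕ) (h : ∀ e ∈ s, ∀ u ∈ G.ends e, edgeConn G.ends s v u → e ∈ t) :
    G.localOmega D s v = G.localOmega D t v :=
  localOmega_congr D (fun _ => ⟨edgeConn_of_forall_mem h, fun h => edgeConn_mono hts h⟩)
    fun e u hu hc => ⟨fun he => h e he u hu hc, fun he => hts he⟩

/-- The component is the single vertex `v` without edges, and the two `D` cancel. Contracted and
untouched vertices can therefore be treated alike in sums over a quotient. -/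
theorem localOmega_of_not_isCovered {G : FeynmanGraph P} {γ : Set G.E} {v : G.V} (D : ℕ)
    (h : ¬ IsCovered G.ends γ v) : G.localOmega D γ v = G.vertexWeight v := by
  classical
  have h1 : (Finset.univ.filter fun u => edgeConn G.ends γ v u) = {v} := by
    ext u
    simp only [Finset.mem_filter, Finset.mem_univ, true_and, Finset.mem_singleton]
    exact ⟨fun hu => (eq_of_edgeConn_of_not_isCovered hu h).symm,
      by rintro rfl; exact (edgeConn _ _).refl' u⟩
  have h2 : (Finset.univ.filter fun e => e ∈ γ ∧ ∀ u ∈ G.ends e, edgeConn G.ends γ v u) = ∅ := by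
    refine Finset.filter_eq_empty_iff.2 fun e _ ⟨he, hc⟩ => ?_
    have hu := Sym2.out_fst_mem (G.ends e)
    have := eq_of_edgeConn_of_not_isCovered (hc _ hu) h
    exact h ⟨e, he, by rw [this]; exact hu⟩
  unfold localOmega
  rw [h1, h2, Finset.sum_singleton, Finset.sum_empty]
  ring

/-- A connected graph has `E - V + 1` loops, which distributes `D * L` over edges and vertices. -/
theorem component_omega (G : FeynmanGraph P) (D : ℕ) (x : G.V) :
    (G.component (Quotient.mk _ x)).omega D = G.localOmega D Set.univ x := by
  classical
  set γ := G.edgesOf (Quotient.mk _ x) with hγ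
  have hcov : ∀ v : G.V, edgeConn G.ends Set.univ x v ↔ ∃ e ∈ γ, v ∈ G.ends e := by
    intro v
    constructor
    · intro hv
      obtain ⟨e, he⟩ := G.no_isolated v
      exact ⟨e, mem_edgesOf_of_mem he hv, he⟩
    · rintro ⟨e, he, hv⟩
      exact mem_edgesOf_iff.1 he v hv
  have hconn : ∀ v w : (G.sub γ).V, (G.sub γ).Joined v w := by
    intro v w
    have hv := (hcov v.1).2 v.2
    refine sub_joined_iff.2 (edgeConn_of_forall_mem (fun e _ u hu hc => ?_)
      ((edgeConn _ _).trans' ((edgeConn _ _).symm' hv) ((hcov w.1).2 w.2)))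
    exact mem_edgesOf_of_mem hu ((edgeConn _ _).trans' hv hc)
  have hone : Nat.card (Quotient (edgeConn (G.sub γ).ends Set.univ)) = 1 := by
    rw [Nat.card_eq_one_iff_unique]
    refine ⟨⟨fun c d => ?_⟩, ⟨Quotient.mk _ ⟨x, (hcov x).1 ((edgeConn _ _).refl' x)⟩⟩⟩
    induction c using Quotient.ind with | _ c => ?_
    induction d using Quotient.ind with | _ d => ?_
    exact Quotient.sound (hconn c d)
  have hV : ∀ f : G.V → ℝ, ∑ v : (G.sub γ).V, f v.1 =
      ∑ u with edgeConn G.ends Set.univ x u, f u := fun f =>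
    (Finset.sum_subtype _ (fun u => by simpa using hcov u) f).symm
  have hE : ∀ f : G.E → ℝ, ∑ e : (G.sub γ).E, f e.1 =
      ∑ e with ∀ u ∈ G.ends e, edgeConn G.ends Set.univ x u, f e := fun f =>
    (Finset.sum_subtype _ (fun e => by simpa using mem_edgesOf_iff.symm) f).symm
  have hloops : ((G.sub γ).loops Set.univ : ℝ) =
      ∑ e : (G.sub γ).E, (1 : ℝ) + 1 - ∑ v : (G.sub γ).V, (1 : ℝ) := by
    unfold loops loopNumber
    rw [hone, Nat.card_coe_set_eq, Set.ncard_univ, Nat.card_eq_fintype_card,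
      Nat.card_eq_fintype_card]
    simp
  change D * ((G.sub γ).loops Set.univ : ℝ) + ∑ v : (G.sub γ).V, G.vertexWeight v.1 -
    ∑ e : (G.sub γ).E, G.edgeWeight e.1 = _
  rw [hloops, hV fun _ => 1, hE fun _ => 1, hV, hE, localOmega_univ, Finset.sum_sub_distrib,
    Finset.sum_sub_distrib, mul_sub, mul_add, Finset.mul_sum, Finset.mul_sum]
  simp only [mul_one]
  ring

/-- All nontrivial components of `γ` have degree of divergence zero. -/
def IsLogOn (G : FeynmanGraph P) (D : ℕ) (γ : Set G.E) : Prop :=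
  ∀ v, IsCovered G.ends γ v → G.localOmega D γ v = 0

namespace IntervalPresentation

variable {G H : FeynmanGraph P} {a b : Set G.E}

-- The `b`-component of `v` is partitioned into the `a`-components over the vertices `y` joined to
-- `x` in `H`. Its edges in `a` belong to one of these each, and its remaining edges are the edges
-- of the component of `x`. The `-D` removes the constant in each `localOmega`.
open Classical in
theorem localOmega_fiberwise (R : IntervalPresentation G H a b) (D : ℕ) {v : G.V} {x : H.V}
    (hv : R.fiber v x) {r : H.V → G.V} (hr : ∀ y, R.rel (r y) y) :
    G.localOmega D b v = D + ∑ y with H.Joined x y, (G.localOmega D a (r y) - D) +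
      ∑ e with ∀ u ∈ H.ends e, H.Joined x u, (D - H.edgeWeight e) := by
  have hfib : ∀ {u}, edgeConn G.ends b v u → ∃ y, R.fiber u y ∧ H.Joined x y := by
    intro u hu
    rw [← R.lift_univ] at hu
    exact R.exists_fiber_of_edgeConn_lift hv hu
  -- `c` sends a vertex to the one of `H` that it lies over. The default `x` is irrelevant, as every
  -- vertex joined to `v` by `b` lies in a fiber.
  obtain ⟨c, hc⟩ : ∃ c : G.V → H.V, ∀ u y, R.fiber u y → c u = y := by
    refine ⟨fun u => if h : ∃ y, R.fiber u y then h.choose else x, fun u y h => ?_⟩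
    have h' : ∃ y, R.fiber u y := ⟨y, h⟩
    refine (dif_pos h').trans ?_
    exact (R.fiber_eq_iff h'.choose_spec h).2 ((edgeConn _ _).refl' u)
  have hab := edgeConn_mono (ends := G.ends) R.subset
  have hcu : ∀ {u}, edgeConn G.ends b v u → H.Joined x (c u) ∧ R.fiber u (c u) := by
    intro u hu
    obtain ⟨y, hy, hxy⟩ := hfib hu
    rw [hc u y hy]
    exact ⟨hxy, hy⟩
  have hry : ∀ {y u}, H.Joined x y → edgeConn G.ends a (r y) u →
      edgeConn G.ends b v u ∧ c u = y := by
    intro y u hxy hu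
    have hf := R.fiber_of_edgeConn (R.fiber_of_rel (hr y)) hu
    exact ⟨(R.joined_iff hv hf).1 hxy, hc u y hf⟩
  have hry' : ∀ {y u}, edgeConn G.ends b v u → c u = y → edgeConn G.ends a (r y) u := by
    rintro _ u hu rfl
    exact (R.fiber_eq_iff (R.fiber_of_rel (hr _)) (hcu hu).2).1 rfl
  have hA : ∑ u with edgeConn G.ends b v u, (G.vertexWeight u - (D : ℝ)) =
      ∑ y with H.Joined x y, ∑ u with edgeConn G.ends a (r y) u, (G.vertexWeight u - (D : ℝ)) := by
    rw [← Finset.sum_fiberwise_of_maps_to (g := c) (t := Finset.univ.filter fun y => H.Joined x y)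
      (fun u hu => by simpa using (hcu (by simpa using hu)).1)]
    refine Finset.sum_congr rfl fun y hy => Finset.sum_congr ?_ fun _ _ => rfl
    have hy : H.Joined x y := by simpa using hy
    ext u
    simp only [Finset.mem_filter, Finset.mem_univ, true_and]
    exact ⟨fun h => hry' h.1 h.2, hry hy⟩
  have hB : ∑ e with (e ∈ b ∧ ∀ u ∈ G.ends e, edgeConn G.ends b v u) ∧ e ∈ a,
        ((D : ℝ) - G.edgeWeight e) =
      ∑ y with H.Joined x y, ∑ e with e ∈ a ∧ ∀ u ∈ G.ends e, edgeConn G.ends a (r y) u,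
        ((D : ℝ) - G.edgeWeight e) := by
    -- An edge of `a` has both ends in the same fiber, so any chosen end tells to which `y` the edge
    -- belongs.
    have hout : ∀ e, (G.ends e).out.1 ∈ G.ends e := fun e => Sym2.out_fst_mem _
    rw [← Finset.sum_fiberwise_of_maps_to (g := fun e => c (G.ends e).out.1)
      (t := Finset.univ.filter fun y => H.Joined x y)]
    · refine Finset.sum_congr rfl fun y hy => Finset.sum_congr ?_ fun _ _ => rfl
      have hy : H.Joined x y := by simpa using hy
      ext e
      simp only [Finset.mem_filter, Finset.mem_univ, true_and]
      constructor
      · rintro ⟨⟨⟨-, h⟩, he⟩, hcy⟩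
        exact ⟨he, fun u hu => edgeConn_ends he (hout e) (hry' (h _ (hout e)) hcy) hu⟩
      · rintro ⟨he, h⟩
        exact ⟨⟨⟨R.subset he, fun u hu => (hry hy (h u hu)).1⟩, he⟩, (hry hy (h _ (hout e))).2⟩
    · intro e he
      simp only [Finset.mem_filter, Finset.mem_univ, true_and] at he ⊢
      exact (hcu (he.1.2 _ (hout e))).1
  have hC : ∑ e with (e ∈ b ∧ ∀ u ∈ G.ends e, edgeConn G.ends b v u) ∧ e ∉ a,
        ((D : ℝ) - G.edgeWeight e) =
      ∑ e with ∀ u ∈ H.ends e, H.Joined x u, ((D : ℝ) - H.edgeWeight e) := by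
    symm
    refine Finset.sum_bij (fun e _ => R.edge e) ?_ (fun _ _ _ _ h => R.edge_injective h) ?_ ?_
    · intro e he
      simp only [Finset.mem_filter, Finset.mem_univ, true_and] at he ⊢
      refine ⟨⟨R.edge_mem e, fun u hu => ?_⟩, R.edge_notMem e⟩
      obtain ⟨y, hy, h⟩ := R.exists_rel_of_mem_ends hu
      exact (R.joined_iff hv (R.fiber_of_rel h)).1 (he y hy)
    · intro e he
      simp only [Finset.mem_filter, Finset.mem_univ, true_and] at he ⊢
      obtain ⟨e, rfl⟩ := R.exists_edge_eq he.1.1 he.2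
      refine ⟨e, fun y hy => ?_, rfl⟩
      obtain ⟨u, hu, h⟩ := R.exists_rel_of_mem hy
      exact (R.joined_iff hv (R.fiber_of_rel h)).2 (he.1.2 u hu)
    · intro e _
      rw [R.edgeWeight_eq]
  have hBC := Finset.sum_filter_add_sum_filter_not
    (Finset.univ.filter fun e => e ∈ b ∧ ∀ u ∈ G.ends e, edgeConn G.ends b v u) (· ∈ a)
    (fun e => (D : ℝ) - G.edgeWeight e)
  rw [Finset.filter_filter, Finset.filter_filter, hB, hC] at hBC
  rw [localOmega, hA, ← hBC, ← add_assoc, add_assoc (D : ℝ), ← Finset.sum_add_distrib]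
  congr 2
  refine Finset.sum_congr rfl fun y _ => ?_
  rw [localOmega]
  ring

open Classical in
/-- The degree of divergence of a component splits into those of the contracted graph and of the
contracted subgraphs. -/
theorem localOmega_eq_add (R : IntervalPresentation G H a b) (D : ℕ) {v : G.V} {x : H.V}
    (hv : R.fiber v x) {r : H.V → G.V} (hr : ∀ y, R.rel (r y) y) :
    G.localOmega D b v = H.localOmega D Set.univ x +
      ∑ y with H.Joined x y, if IsCovered G.ends a (r y) then G.localOmega D a (r y) else 0 := by
  have key : ∀ y, G.localOmega D a (r y) - D = (H.vertexWeight y - D) +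
      if IsCovered G.ends a (r y) then G.localOmega D a (r y) else 0 := by
    intro y
    rw [R.vertexWeight_eq (hr y)]
    split_ifs with h
    · ring
    · rw [localOmega_of_not_isCovered D h]; ring
  rw [R.localOmega_fiberwise D hv hr, Finset.sum_congr rfl fun y _ => key y,
    Finset.sum_add_distrib, localOmega_univ]
  ring

theorem localOmega_eq (R : IntervalPresentation G H a b) {D : ℕ} (ha : G.IsLogOn D a) {v : G.V}
    {x : H.V} (hv : R.fiber v x) : H.localOmega D Set.univ x = G.localOmega D b v := by
  classical
  choose r hr using R.exists_rel
  rw [R.localOmega_eq_add D hv hr, Finset.sum_eq_zero, add_zero]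
  intro y _
  split_ifs with h
  exacts [ha _ h, rfl]

theorem isCovered_of_rel (R : IntervalPresentation G H a b) {v : G.V} {x : H.V}
    (h : R.rel v x) : IsCovered G.ends b v := by
  rw [← R.lift_univ, R.isCovered_lift_iff h]
  obtain ⟨e, he⟩ := H.no_isolated x
  exact Or.inr ⟨e, Set.mem_univ e, he⟩

/-- A vertex of `G` either lies over a vertex of `H` up to joining by `b`, or its component in `b`
is one of `a`. -/
theorem exists_rel_or (R : IntervalPresentation G H a b) (v : G.V) :
    (∃ u x, R.rel u x ∧ edgeConn G.ends b v u) ∨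
      ∀ e ∈ b, ∀ u ∈ G.ends e, edgeConn G.ends b v u → e ∈ a := by
  by_cases h : ∀ e ∈ b, ∀ u ∈ G.ends e, edgeConn G.ends b v u → e ∈ a
  · exact Or.inr h
  · push Not at h
    obtain ⟨e, he, u, hu, hvu, hea⟩ := h
    obtain ⟨e, rfl⟩ := R.exists_edge_eq he hea
    obtain ⟨x, -, hx⟩ := R.exists_rel_of_mem_ends hu
    exact Or.inl ⟨u, x, hx, hvu⟩

theorem localOmega_eq_zero (R : IntervalPresentation G H a b) {D : ℕ} (ha : G.IsLogOn D a)
    (hb : G.IsLogOn D b) (x : H.V) : H.localOmega D Set.univ x = 0 := by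
  obtain ⟨v, hv⟩ := R.exists_rel x
  rw [R.localOmega_eq ha (R.fiber_of_rel hv)]
  exact hb v (R.isCovered_of_rel hv)

/-- A component of `b` with an edge outside `a` has the degree of a component of `H`, since
contracting logarithmic pieces changes nothing. Any other component of `b` is one of `a`, of degree
zero. -/
theorem localOmega_nonneg_of_nonneg (R : IntervalPresentation G H a b) {D : ℕ}
    (ha : G.IsLogOn D a) (hH : ∀ x, 0 ≤ H.localOmega D Set.univ x) {v : G.V}
    (hv : IsCovered G.ends b v) : 0 ≤ G.localOmega D b v := by
  rcases R.exists_rel_or v with ⟨u, x, hx, hvu⟩ | h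
  · rw [localOmega_of_edgeConn D hvu, ← R.localOmega_eq ha (R.fiber_of_rel hx)]
    exact hH x
  · rw [localOmega_of_forall_mem R.subset D h]
    obtain ⟨e, he, hve⟩ := hv
    exact (ha v ⟨e, h e he v hve ((edgeConn _ _).refl' v), hve⟩).ge

/-- By `localOmega_eq_add`, the degree zero of a component of `b` is a sum of nonpositive degrees,
so each of them vanishes. -/
theorem isLogOn_of_nonpos (R : IntervalPresentation G H a b) {D : ℕ} (hb : G.IsLogOn D b)
    (ha : ∀ v, IsCovered G.ends a v → G.localOmega D a v ≤ 0)
    (hH : ∀ x, H.localOmega D Set.univ x ≤ 0) : G.IsLogOn D a := by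
  classical
  intro v hv
  have hvb : IsCovered G.ends b v := by
    obtain ⟨e, he, hve⟩ := hv
    exact ⟨e, R.subset he, hve⟩
  rcases R.exists_rel_or v with ⟨u, x, hx, hvu⟩ | h
  · choose r hr using R.exists_rel
    have hsum := R.localOmega_eq_add D (R.fiber_of_rel hx) hr
    rw [← localOmega_of_edgeConn D hvu, hb v hvb] at hsum
    have huv := (edgeConn _ _).symm' hvu
    rw [← R.lift_univ] at huv
    obtain ⟨y, hy, hxy⟩ := R.exists_fiber_of_edgeConn_lift (R.fiber_of_rel hx) huv
    have hnonpos : ∀ z ∈ Finset.univ.filter (fun z => H.Joined x z),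
        (if IsCovered G.ends a (r z) then G.localOmega D a (r z) else 0) ≤ 0 := by
      intro z _
      split_ifs with h
      exacts [ha _ h, le_rfl]
    have hzero := (Finset.sum_eq_zero_iff_of_nonpos hnonpos).1
      (le_antisymm (Finset.sum_nonpos hnonpos) (by linarith [hH x])) y (by simpa using hxy)
    have hvr := (R.fiber_eq_iff hy (R.fiber_of_rel (hr y))).1 rfl
    rwa [if_pos (hv.of_edgeConn hvr), ← localOmega_of_edgeConn D hvr] at hzero
  · rw [← localOmega_of_forall_mem R.subset D h]
    exact hb v hvb

end IntervalPresentation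

variable {G : FeynmanGraph P} {D : ℕ}

theorem isLogDivergent_iff : G.IsLogDivergent D ↔ ∀ x, G.localOmega D Set.univ x = 0 := by
  simp only [← component_omega]
  exact Quotient.forall

theorem IsScaleless.isUVDivergent_iff (hG : G.IsScaleless) (hm : G.IsMotic) :
    G.IsUVDivergent D ↔ ∀ x, 0 ≤ G.localOmega D Set.univ x := by
  simp only [← component_omega]
  exact (forall_congr' fun c => and_iff_right (hG.component_isOnePI hm c)).trans Quotient.forall

theorem IsScaleless.isIRDivergent_iff (hG : G.IsScaleless) :
    G.IsIRDivergent D ↔ ∀ x, G.localOmega D Set.univ x ≤ 0 := by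
  simp only [← component_omega]
  exact (and_iff_right hG).trans Quotient.forall

theorem IsScaleless.localOmega_sub (hG : G.IsScaleless) {γ : Set G.E} (x : SubV G.ends γ) :
    (G.sub γ).localOmega D Set.univ x = G.localOmega D γ x.1 := by
  have hγ : (IntervalPresentation.self hG).lift γ = γ := by
    simp [IntervalPresentation.lift, IntervalPresentation.self]
  -- The subgraph is viewed as `γ / ∅`; the empty set is vacuously logarithmic.
  have := ((IntervalPresentation.self hG).sub γ).localOmega_eq (D := D) (v := x.1) (x := x)
    (fun v ⟨e, he, _⟩ => he.elim) (IntervalPresentation.fiber_of_rel _ rfl)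
  rwa [hγ] at this

theorem IsScaleless.isLogOn_of_nonneg (hG : G.IsScaleless) (h : G.HasOnlyLogSubdivergences D)
    {γ : Set G.E} (hγ : Bridgeless G.ends γ)
    (hω : ∀ v, IsCovered G.ends γ v → 0 ≤ G.localOmega D γ v) : G.IsLogOn D γ := by
  intro v hv
  have hm := hG.isMotic_sub_iff.2 hγ
  have := isLogDivergent_iff.1 (h γ hm (((hG.sub γ).isUVDivergent_iff hm).2 fun x => ?_)) ⟨v, hv⟩
  · rwa [hG.localOmega_sub] at this
  · exact (hω _ x.2).trans_eq (hG.localOmega_sub x).symm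

theorem IsScaleless.localOmega_nonpos (hG : G.IsScaleless) (h : G.HasOnlyLogSubdivergences D)
    {γ : Set G.E} (hγ : Bridgeless G.ends γ) {v : G.V} (hv : IsCovered G.ends γ v) :
    G.localOmega D γ v ≤ 0 := by
  by_contra! hpos
  -- The component of `v` is taken alone, since other components of `γ` may have negative degree. By
  -- itself it is a UV divergent subgraph that is not logarithmic.
  let δ : Set G.E := {e | e ∈ γ ∧ ∃ u ∈ G.ends e, edgeConn G.ends γ v u}
  have hδγ : δ ⊆ γ := fun e he => he.1
  have hδ : Bridgeless G.ends δ := by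
    refine hγ.of_forall_mem hδγ fun e he u hu f hf w hw huw => ⟨hf, w, hw, ?_⟩
    obtain ⟨he, u', hu', hvu'⟩ := he
    exact (edgeConn _ _).trans' (edgeConn_ends he hu' hvu' hu) huw
  have hω : ∀ u, edgeConn G.ends γ v u → G.localOmega D δ u = G.localOmega D γ v := by
    intro u hu
    rw [localOmega_of_edgeConn D hu]
    exact (localOmega_of_forall_mem hδγ D fun e he w hw hc =>
      ⟨he, w, hw, (edgeConn _ _).trans' hu hc⟩).symm
  have hlog := hG.isLogOn_of_nonneg h hδ fun u ⟨e, he, hu⟩ => by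
    obtain ⟨he, w, hw, hvw⟩ := he
    rw [hω u (edgeConn_ends he hw hvw hu)]
    exact hpos.le
  obtain ⟨e, he, hve⟩ := hv
  have hvv := (edgeConn G.ends γ).refl' v
  have := hlog v ⟨e, ⟨he, v, hve, hvv⟩, hve⟩
  rw [hω v hvv] at this
  exact hpos.ne' this

end FeynmanGraph

/-! ### Convolution over motic subgraphs, and the antipode. -/

section MoticConvolution

variable {P : Type u} [AddCommGroup P]

namespace MoticClass

theorem mk_eq_mk_iff {G H : MoticGraph P} : mk G = mk H ↔ Nonempty (Iso G.1 H.1) :=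
  Quotient.eq

theorem mk_rep (x : MoticClass P) : mk x.rep = x := Quotient.out_eq x

theorem nonempty_iso_rep (G : MoticGraph P) : Nonempty (Iso (mk G).rep.1 G.1) :=
  mk_eq_mk_iff.1 (mk_rep _)

theorem mk_eq_one_iff {G : MoticGraph P} : mk G = 1 ↔ IsEmpty G.1.E := by
  have h1 : (1 : MoticClass P) = mk ⟨FeynmanGraph.empty P, isMotic_empty⟩ := rfl
  rw [h1, mk_eq_mk_iff]
  constructor
  · rintro ⟨f⟩
    exact ⟨fun e => (f.toE e : Empty).elim⟩
  · intro hE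
    have hV : IsEmpty G.1.V := ⟨fun v => hE.elim (G.1.no_isolated v).choose⟩
    exact ⟨⟨Equiv.equivOfIsEmpty G.1.V Empty, Equiv.equivOfIsEmpty G.1.E Empty,
      fun e => hE.elim e, fun e => hE.elim e, fun v => hV.elim v, fun e => hE.elim e,
      fun v => hV.elim v⟩⟩

/-- A class of scaleless graphs. -/
def IsScaleless (x : MoticClass P) : Prop := x.rep.1.IsScaleless

theorem isScaleless_mk {G : MoticGraph P} (h : G.1.IsScaleless) : (mk G).IsScaleless := by
  obtain ⟨f⟩ := nonempty_iso_rep G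
  exact h.of_iso f.symm

theorem eq_one_iff {x : MoticClass P} : x = 1 ↔ IsEmpty x.rep.1.E := by
  conv_lhs => rw [← mk_rep x]
  exact mk_eq_one_iff

end MoticClass

open MoticClass

theorem extendLinear_toAlg {N : Type*} [AddCommGroup N] [Module ℚ N] (f : MoticClass P → N)
    (x : MoticClass P) : extendLinear f x.toAlg = f x :=
  (MonoidAlgebra.basis (MoticClass P) ℚ).constr_basis ℚ f x

namespace MoticSub

variable {x : MoticClass P}

theorem subClass_isScaleless (hx : x.IsScaleless) (γ : MoticSub x.rep) :
    γ.subClass.IsScaleless :=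
  isScaleless_mk (hx.sub γ.1)

theorem subClass_eq_one_iff {γ : MoticSub x.rep} : γ.subClass = 1 ↔ γ.1 = ∅ := by
  rw [subClass, mk_eq_one_iff]
  exact Set.isEmpty_coe_sort

theorem quotClass_eq_one_iff {γ : MoticSub x.rep} : γ.quotClass = 1 ↔ γ.1 = Set.univ := by
  rw [quotClass, mk_eq_one_iff]
  exact Set.isEmpty_coe_sort.trans Set.compl_empty_iff

/-- The empty subgraph. -/
def bot (hx : x.IsScaleless) : MoticSub x.rep := ⟨∅, hx.isMotic_sub_iff.2 bridgeless_empty⟩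

/-- The full subgraph. -/
def top (hx : x.IsScaleless) : MoticSub x.rep :=
  ⟨Set.univ, hx.isMotic_sub_iff.2 (hx.isMotic_iff.1 x.rep.2)⟩

theorem subClass_bot (hx : x.IsScaleless) : (bot hx).subClass = 1 := subClass_eq_one_iff.2 rfl

theorem quotClass_top (hx : x.IsScaleless) : (top hx).quotClass = 1 := quotClass_eq_one_iff.2 rfl

theorem subClass_top (hx : x.IsScaleless) : (top hx).subClass = x := by
  conv_rhs => rw [← mk_rep x]
  refine mk_eq_mk_iff.2 ?_
  have R := (IntervalPresentation.self hx).sub Set.univ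
  rw [IntervalPresentation.lift_univ] at R
  exact R.nonempty_iso (IntervalPresentation.self hx)

theorem quotClass_bot (hx : x.IsScaleless) : (bot hx).quotClass = x := by
  conv_rhs => rw [← mk_rep x]
  refine mk_eq_mk_iff.2 ?_
  have R := (IntervalPresentation.self hx).quot ∅
  rw [IntervalPresentation.lift_empty] at R
  exact R.nonempty_iso (IntervalPresentation.self hx)

end MoticSub

open MoticSub

section Convolution

variable {B : Type*} [CommRing B]

/-- The convolution `∑ f(γ) g(Γ / γ)` over the motic subgraphs. -/
noncomputable def moticConv (f g : MoticClass P → B) (x : MoticClass P) : B :=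
  ∑ γ : MoticSub x.rep, f γ.subClass * g γ.quotClass

theorem moticConv_one (f g : MoticClass P → B) : moticConv f g 1 = f 1 * g 1 := by
  have hE : IsEmpty (1 : MoticClass P).rep.1.E := eq_one_iff.1 rfl
  have hs : (1 : MoticClass P).IsScaleless :=
    ⟨fun v => hE.elim ((1 : MoticClass P).rep.1.no_isolated v).choose, fun e => hE.elim e⟩
  have : Subsingleton (MoticSub (1 : MoticClass P).rep) :=
    ⟨fun γ δ => Subtype.ext (Set.ext fun e => hE.elim e)⟩
  rw [moticConv, Fintype.sum_subsingleton _ (bot hs), subClass_bot, quotClass_bot]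

theorem moticConv_eq (f g : MoticClass P → B) {x : MoticClass P} (hx : x.IsScaleless)
    (hx1 : x ≠ 1) : moticConv f g x = f 1 * g x + f x * g 1 +
      ∑ γ : {γ : MoticSub x.rep // γ.1 ≠ ∅ ∧ γ.1 ≠ Set.univ},
        f γ.1.subClass * g γ.1.quotClass := by
  classical
  have hne : bot hx ≠ top hx := by
    intro h
    have : (∅ : Set x.rep.1.E) = Set.univ := congrArg Subtype.val h
    exact hx1 (eq_one_iff.2 (Set.univ_eq_empty_iff.1 this.symm))
  have h1 : ∀ γ : MoticSub x.rep, γ ∈ (Finset.univ.erase (bot hx)).erase (top hx) ↔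
      γ.1 ≠ ∅ ∧ γ.1 ≠ Set.univ := by
    intro γ
    rw [Finset.mem_erase, Finset.mem_erase, ne_eq, ne_eq, Subtype.ext_iff, Subtype.ext_iff]
    exact ⟨fun h => ⟨h.2.1, h.1⟩, fun h => ⟨h.2, h.1, Finset.mem_univ _⟩⟩
  rw [moticConv, ← Finset.add_sum_erase _ _ (Finset.mem_univ (bot hx)),
    ← Finset.add_sum_erase _ _ (Finset.mem_erase.2 ⟨hne.symm, Finset.mem_univ (top hx)⟩),
    subClass_bot, quotClass_bot, subClass_top, quotClass_top, ← add_assoc,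
    Finset.sum_subtype _ h1]

/-- This is the defining recursion of `S`, with the summands for the empty and the full subgraph
moved to the same side. -/
theorem moticConv_antipodeClass {x : MoticClass P} (hx : x.IsScaleless) (hx1 : x ≠ 1) :
    moticConv antipodeClass toAlg x = 0 := by
  classical
  have h1 : (toAlg (1 : MoticClass P)) = 1 := map_one _
  have h2 : antipodeClass (1 : MoticClass P) = 1 := by rw [antipodeClass, if_pos rfl]
  rw [moticConv_eq _ _ hx hx1, h1, h2]
  conv_lhs => enter [1, 2, 1]; rw [antipodeClass, if_neg hx1]
  ring

end Convolution

/-! ### The matrix of a map on graphs, indexed by bridgeless edge sets. -/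

namespace FeynmanGraph

/-- The class of the graph `b / a`. -/
noncomputable def intervalClass (G : FeynmanGraph P) (a b : Set G.E) : MoticClass P :=
  open Classical in
  if h : ∃ H : MoticGraph P, Nonempty (IntervalPresentation G H.1 a b) then
    MoticClass.mk h.choose else 1

variable {G : FeynmanGraph P}

theorem IntervalPresentation.intervalClass_eq {a b : Set G.E} {H : MoticGraph P}
    (R : IntervalPresentation G H.1 a b) : G.intervalClass a b = MoticClass.mk H := by
  have h : ∃ H : MoticGraph P, Nonempty (IntervalPresentation G H.1 a b) := ⟨H, ⟨R⟩⟩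
  rw [intervalClass, dif_pos h]
  obtain ⟨R'⟩ := h.choose_spec
  exact mk_eq_mk_iff.2 (R'.nonempty_iso R)

/-- The quotient by `a` of the subgraph `b` is a presentation, and it is motic because `b` is
bridgeless. So the default value in `intervalClass` does not occur for such pairs. -/
theorem IsScaleless.nonempty_presentation (hG : G.IsScaleless) {a b : Set G.E}
    (hb : Bridgeless G.ends b) (hab : a ⊆ b) :
    Nonempty (IntervalPresentation G (G.intervalClass a b).rep.1 a b) := by
  suffices h : ∃ H : MoticGraph P, Nonempty (IntervalPresentation G H.1 a b) by
    obtain ⟨H, ⟨R⟩⟩ := h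
    rw [R.intervalClass_eq]
    obtain ⟨f⟩ := nonempty_iso_rep H
    exact ⟨R.ofIso f.symm⟩
  let R := IntervalPresentation.self hG
  obtain ⟨μ, rfl⟩ := R.exists_lift_eq (Set.empty_subset b) (Set.subset_univ b)
  obtain ⟨ν, rfl⟩ := (R.sub μ).exists_lift_eq (Set.empty_subset a) hab
  have hm : (G.sub μ).IsMotic := hG.isMotic_sub_iff.2 ((R.bridgeless_iff bridgeless_empty).2 hb)
  exact ⟨⟨(G.sub μ).quot ν, hm.quot ν⟩, ⟨(R.sub μ).quot ν⟩⟩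

theorem IsScaleless.intervalClass_isScaleless (hG : G.IsScaleless) {a b : Set G.E}
    (hb : Bridgeless G.ends b) (hab : a ⊆ b) : (G.intervalClass a b).IsScaleless :=
  (hG.nonempty_presentation hb hab).some.scaleless

theorem IsScaleless.intervalClass_eq_one_iff (hG : G.IsScaleless) {a b : Set G.E}
    (hb : Bridgeless G.ends b) (hab : a ⊆ b) : G.intervalClass a b = 1 ↔ a = b := by
  obtain ⟨R⟩ := hG.nonempty_presentation hb hab
  rw [eq_one_iff, ← Set.range_eq_empty_iff (f := R.edge), R.range_edge, Set.sdiff_eq_empty]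
  exact ⟨fun h => hab.antisymm h, fun h => h.ge⟩

theorem intervalClass_empty_univ {G : MoticGraph P} (hG : G.1.IsScaleless) :
    G.1.intervalClass ∅ Set.univ = MoticClass.mk G :=
  (IntervalPresentation.self hG).intervalClass_eq

/-- The bridgeless edge sets. -/
abbrev BridgelessSet (G : FeynmanGraph P) : Type := {γ : Set G.E // Bridgeless G.ends γ}

noncomputable instance (G : FeynmanGraph P) : Fintype G.BridgelessSet := Fintype.ofFinite _

variable {B : Type*} [CommRing B]

open Classical in
/-- The matrix `f(b / a)` over the bridgeless edge sets `a ⊆ b`. -/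
noncomputable def intervalMatrix (G : FeynmanGraph P) (f : MoticClass P → B) :
    Matrix G.BridgelessSet G.BridgelessSet B :=
  fun a b => if a.1 ⊆ b.1 then f (G.intervalClass a.1 b.1) else 0

theorem intervalMatrix_of_subset {f : MoticClass P → B} {a b : G.BridgelessSet}
    (h : a.1 ⊆ b.1) : G.intervalMatrix f a b = f (G.intervalClass a.1 b.1) := if_pos h

theorem intervalMatrix_of_not_subset {f : MoticClass P → B} {a b : G.BridgelessSet}
    (h : ¬ a.1 ⊆ b.1) : G.intervalMatrix f a b = 0 := if_neg h

theorem IsScaleless.intervalMatrix_self (hG : G.IsScaleless) {f : MoticClass P → B}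
    (hf : f 1 = 1) (a : G.BridgelessSet) : G.intervalMatrix f a a = 1 := by
  rw [intervalMatrix_of_subset subset_rfl,
    (hG.intervalClass_eq_one_iff a.2 subset_rfl).2 rfl, hf]

/-- Coassociativity: motic subgraphs of `b / a` and their quotients are the intervals `c / a` and
`b / c`. -/
theorem IsScaleless.intervalMatrix_mul (hG : G.IsScaleless) (f g : MoticClass P → B)
    {a b : G.BridgelessSet} (hab : a.1 ⊆ b.1) :
    (G.intervalMatrix f * G.intervalMatrix g) a b =
      moticConv f g (G.intervalClass a.1 b.1) := by
  classical
  obtain ⟨R⟩ := hG.nonempty_presentation b.2 hab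
  have hR := R.scaleless
  have hsum : (G.intervalMatrix f * G.intervalMatrix g) a b =
      ∑ c with a.1 ⊆ c.1 ∧ c.1 ⊆ b.1, G.intervalMatrix f a c * G.intervalMatrix g c b := by
    rw [Matrix.mul_apply, Finset.sum_filter]
    refine Finset.sum_congr rfl fun c _ => ?_
    split_ifs with h
    · rfl
    · rcases not_and_or.1 h with h | h
      · rw [intervalMatrix_of_not_subset h, zero_mul]
      · rw [intervalMatrix_of_not_subset h, mul_zero]
  rw [hsum, moticConv]
  symm
  -- A motic subgraph of `b / a` corresponds to its lift `c`; `bridgeless_iff` matches the two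
  -- conditions. Its subgraph and quotient present `c / a` and `b / c`, hence represent these
  -- interval classes.
  refine Finset.sum_bij
    (fun γ _ => ⟨R.lift γ.1, (R.bridgeless_iff a.2).1 (hR.isMotic_sub_iff.1 γ.2)⟩) ?_ ?_ ?_ ?_
  · intro γ _
    exact Finset.mem_filter.2 ⟨Finset.mem_univ _, R.subset_lift _, R.lift_subset _⟩
  · intro γ _ δ _ h
    exact Subtype.ext (R.lift_injective (congrArg Subtype.val h))
  · rintro ⟨c, hc⟩ h
    obtain ⟨h1, h2⟩ := (Finset.mem_filter.1 h).2
    obtain ⟨μ, rfl⟩ := R.exists_lift_eq h1 h2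
    exact ⟨⟨μ, hR.isMotic_sub_iff.2 ((R.bridgeless_iff a.2).2 hc)⟩, Finset.mem_univ _, rfl⟩
  · intro γ _
    rw [intervalMatrix_of_subset (R.subset_lift γ.1), intervalMatrix_of_subset (R.lift_subset γ.1)]
    congr 2
    · exact ((R.sub γ.1).intervalClass_eq (H := ⟨_, γ.2⟩)).symm
    · exact ((R.quot γ.1).intervalClass_eq
        (H := ⟨_, (G.intervalClass a.1 b.1).rep.2.quot γ.1⟩)).symm

/-- For `a ⊂ b` the graph `b / a` is scaleless and non-empty, so `h` applies; if `a ⊆ b` fails, no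
`c` lies in between. -/
theorem IsScaleless.intervalMatrix_mul_eq_one [DecidableEq G.BridgelessSet] (hG : G.IsScaleless)
    {f g : MoticClass P → B} (hf : f 1 = 1) (hg : g 1 = 1)
    (h : ∀ x : MoticClass P, x.IsScaleless → x ≠ 1 → moticConv f g x = 0) :
    G.intervalMatrix f * G.intervalMatrix g = 1 := by
  ext a b
  by_cases hab : a.1 ⊆ b.1
  · rw [hG.intervalMatrix_mul f g hab]
    by_cases heq : a = b
    · subst heq
      rw [(hG.intervalClass_eq_one_iff a.2 hab).2 rfl, moticConv_one, hf, hg, mul_one,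
        Matrix.one_apply_eq]
    · rw [Matrix.one_apply_ne heq]
      refine h _ (hG.intervalClass_isScaleless b.2 hab) fun h1 => heq (Subtype.ext ?_)
      exact (hG.intervalClass_eq_one_iff b.2 hab).1 h1
  · rw [Matrix.one_apply_ne (by rintro rfl; exact hab subset_rfl), Matrix.mul_apply]
    refine Finset.sum_eq_zero fun c _ => ?_
    by_cases hac : a.1 ⊆ c.1
    · rw [intervalMatrix_of_not_subset fun hcb => hab (hac.trans hcb), mul_zero]
    · rw [intervalMatrix_of_not_subset hac, zero_mul]

end FeynmanGraph

/-! ### Counterterms of scaleless graphs. -/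

section Counterterms

theorem toAlg_one : (1 : MoticClass P).toAlg = 1 := map_one _

theorem antipode_toAlg (x : MoticClass P) : antipode x.toAlg = antipodeClass x :=
  extendLinear_toAlg _ x

theorem FeynmanGraph.IsScaleless.localOmega_iso {G H : FeynmanGraph P} (hG : G.IsScaleless)
    (f : Iso G H) (D : ℕ) (x : G.V) :
    H.localOmega D Set.univ (f.toV x) = G.localOmega D Set.univ x := by
  let R := (IntervalPresentation.self hG).ofIso f
  have hR : R.rel x (f.toV x) := (f.toV.symm_apply_apply x).symm
  exact R.localOmega_eq (fun v ⟨e, he, _⟩ => he.elim) (R.fiber_of_rel hR)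

variable {A : Type v} [CommRing A] [Algebra ℚ A]

theorem tripleProduct_tmul (f g h : MoticAlgebra P →ₗ[ℚ] A) (x y z : MoticAlgebra P) :
    tripleProduct f g h ((x ⊗ₜ[ℚ] y) ⊗ₜ[ℚ] z) = f x * g y * h z := rfl

theorem tripleProduct_coproduct₂ (f g h : MoticAlgebra P →ₗ[ℚ] A) (x : MoticClass P) :
    tripleProduct f g h (coproduct₂ x.toAlg) =
      moticConv (moticConv (fun y => f y.toAlg) fun y => g y.toAlg) (fun y => h y.toAlg) x := by
  rw [coproduct₂, LinearMap.comp_apply, coproduct, extendLinear_toAlg, map_sum, map_sum, moticConv]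
  refine Finset.sum_congr rfl fun γ _ => ?_
  rw [TensorProduct.map_tmul, extendLinear_toAlg, TensorProduct.sum_tmul, map_sum, moticConv,
    Finset.sum_mul]
  rfl

/-- Multiplicativity of `F` turns the products in the recursion of `S` into products in `A`. -/
theorem moticConv_antipode (F : MoticAlgebra P →ₐ[ℚ] A) {x : MoticClass P} (hx : x.IsScaleless)
    (hx1 : x ≠ 1) :
    moticConv (fun y => F (antipodeClass y)) (fun y => F y.toAlg) x = 0 := by
  have := congrArg F (moticConv_antipodeClass hx hx1)
  rwa [moticConv, map_sum, map_zero, Finset.sum_congr rfl fun γ _ => map_mul F _ _] at this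

/-- Only the trivial quotient survives the evaluation of scaleless graphs. -/
theorem moticConv_of_scaleless {φ : MoticAlgebra P →ₗ[ℚ] A} (hφ_one : φ 1 = 1)
    (hφ_scaleless : ∀ Λ : MoticGraph P, Λ.1.IsScaleless → Nonempty Λ.1.E → φ (graphElem Λ) = 0)
    (f : MoticClass P → A) {x : MoticClass P} (hx : x.IsScaleless) :
    moticConv f (fun y => φ y.toAlg) x = f x := by
  rw [moticConv, Finset.sum_eq_single (top hx), subClass_top, quotClass_top, toAlg_one, hφ_one,
    mul_one]
  · intro γ _ hγ
    have hne : Nonempty ↥(γ.1ᶜ) := by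
      rw [Set.nonempty_coe_sort, Set.nonempty_compl]
      exact fun h => hγ (Subtype.ext h)
    have : φ γ.quotClass.toAlg = 0 :=
      hφ_scaleless ⟨x.rep.1.quot γ.1, x.rep.2.quot γ.1⟩ (IsScaleless.quot hx γ.1) hne
    rw [this, mul_zero]
  · exact fun h => (h (Finset.mem_univ _)).elim

variable {D : ℕ} {K : A →+ A} {φ : MoticAlgebra P →ₗ[ℚ] A} {Z Z' : MoticAlgebra P →ₐ[ℚ] A}

theorem IsCountertermPair.uv_eq_zero (hZ : IsCountertermPair D K φ Z Z') {x : MoticClass P}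
    (hx1 : x ≠ 1) (hx : ¬ ∃ G : MoticGraph P, MoticClass.mk G = x ∧ G.1.IsUVDivergent D) :
    Z x.toAlg = 0 := by
  have h0 : rhoUV D x.toAlg = 0 := by rw [rhoUV, extendLinear_toAlg, if_neg hx]
  rw [hZ.uv x hx1, h0]
  simp

theorem IsCountertermPair.ir_eq_zero (hZ : IsCountertermPair D K φ Z Z') {x : MoticClass P}
    (hx1 : x ≠ 1) (hx : ¬ ∃ G : MoticGraph P, MoticClass.mk G = x ∧ G.1.IsIRDivergent D) :
    Z' x.toAlg = 0 := by
  have h0 : rhoIR D x.toAlg = 0 := by rw [rhoIR, extendLinear_toAlg, if_neg hx]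
  rw [hZ.ir x hx1, h0]
  simp

/-- `Z` vanishes on non-empty graphs removed by `rhoUV`. The divergent graph in the class may differ
from the representative, so its degrees are moved along an isomorphism. -/
theorem IsCountertermPair.localOmega_nonneg (hZ : IsCountertermPair D K φ Z Z')
    {x : MoticClass P} (hx : x.IsScaleless) (hx1 : x ≠ 1) (h : Z x.toAlg ≠ 0) (v : x.rep.1.V) :
    0 ≤ x.rep.1.localOmega D Set.univ v := by
  by_contra hv
  refine h (hZ.uv_eq_zero hx1 ?_)
  rintro ⟨G, rfl, hG⟩
  obtain ⟨f⟩ := nonempty_iso_rep G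
  rw [← IsScaleless.localOmega_iso hx f] at hv
  exact hv (((IsScaleless.of_iso hx f).isUVDivergent_iff G.2).1 hG _)

theorem IsCountertermPair.localOmega_nonpos (hZ : IsCountertermPair D K φ Z Z')
    {x : MoticClass P} (hx : x.IsScaleless) (hx1 : x ≠ 1) (h : Z' x.toAlg ≠ 0) (v : x.rep.1.V) :
    x.rep.1.localOmega D Set.univ v ≤ 0 := by
  by_contra hv
  refine h (hZ.ir_eq_zero hx1 ?_)
  rintro ⟨G, rfl, hG⟩
  obtain ⟨f⟩ := nonempty_iso_rep G
  rw [← IsScaleless.localOmega_iso hx f] at hv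
  exact hv ((IsScaleless.of_iso hx f).isIRDivergent_iff.1 hG _)

theorem IsCountertermPair.map_uv (hZ : IsCountertermPair D K φ Z Z') (hK : IsSubtractionScheme K)
    {x : MoticClass P} (hx1 : x ≠ 1) : K (Z x.toAlg) = Z x.toAlg := by
  rw [hZ.uv x hx1, map_neg, hK.idem]

theorem IsCountertermPair.map_ir (hZ : IsCountertermPair D K φ Z Z') (hK : IsSubtractionScheme K)
    {x : MoticClass P} (hx1 : x ≠ 1) : K (Z' x.toAlg) = Z' x.toAlg := by
  rw [hZ.ir x hx1, map_neg, hK.idem]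

/-- The UV and IR counterterms of a logarithmically divergent scaleless graph cancel. -/
theorem IsCountertermPair.moticConv_eq_zero (hZ : IsCountertermPair D K φ Z Z')
    (hK : IsSubtractionScheme K) (hφ_one : φ 1 = 1)
    (hφ_scaleless : ∀ Λ : MoticGraph P, Λ.1.IsScaleless → Nonempty Λ.1.E → φ (graphElem Λ) = 0)
    {x : MoticClass P} (hx : x.IsScaleless) (hx1 : x ≠ 1)
    (hlog : ∀ v, x.rep.1.localOmega D Set.univ v = 0) :
    moticConv (fun y => Z y.toAlg) (fun y => Z' y.toAlg) x = 0 := by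
  have hUV : rhoUV D x.toAlg = x.toAlg := by
    rw [rhoUV, extendLinear_toAlg, if_pos]
    exact ⟨x.rep, mk_rep x,
      (IsScaleless.isUVDivergent_iff hx x.rep.2).2 fun v => (hlog v).ge⟩
  have h3 : tripleProduct Z.toLinearMap φ Z'.toLinearMap (coproduct₂ x.toAlg) =
      moticConv (fun y => Z y.toAlg) (fun y => Z' y.toAlg) x := by
    rw [tripleProduct_coproduct₂]
    exact Finset.sum_congr rfl fun γ _ => congrArg (· * _)
      (moticConv_of_scaleless hφ_one hφ_scaleless _ (subClass_isScaleless hx γ))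
  have uv := hZ.uv x hx1
  rw [hUV, map_sub, h3, tripleProduct_tmul, hφ_one] at uv
  -- For proper subgraphs both factors are counterterms of non-empty graphs. They lie in the image
  -- of `K`, and so does their product.
  have hKB : K (∑ γ : {γ : MoticSub x.rep // γ.1 ≠ ∅ ∧ γ.1 ≠ Set.univ},
        Z γ.1.subClass.toAlg * Z' γ.1.quotClass.toAlg) =
      ∑ γ : {γ : MoticSub x.rep // γ.1 ≠ ∅ ∧ γ.1 ≠ Set.univ},
        Z γ.1.subClass.toAlg * Z' γ.1.quotClass.toAlg := by
    rw [map_sum]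
    refine Finset.sum_congr rfl fun γ _ => ?_
    have h1 := hZ.map_uv hK fun h => γ.2.1 (subClass_eq_one_iff.1 h)
    have h2 := hZ.map_ir hK fun h => γ.2.2 (quotClass_eq_one_iff.1 h)
    rw [← h1, ← h2, hK.mul]
  have hsplit := moticConv_eq (fun y => Z y.toAlg) (fun y => Z' y.toAlg) hx hx1
  simp only [map_one, one_mul, mul_one] at hsplit
  have hone : Z'.toLinearMap 1 = 1 := map_one Z'
  rw [hone, mul_one, mul_one, hsplit] at uv
  change _ = -K (_ - Z x.toAlg) at uv
  -- The subtraction removes `Z x`; what remains under `K`, namely `Z' x` and the proper terms, is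
  -- fixed by `K`.
  rw [show ∀ p q r : A, p + q + r - q = p + r by intros; ring, map_add, hKB, hZ.map_ir hK hx1] at uv
  rw [hsplit, uv]
  ring

/-! ### Substitution along logarithmic edge sets. -/

variable {G : FeynmanGraph P}

/-- A nonzero entry makes the degrees of `b / a` nonnegative, hence those of `b`, as `a` is
logarithmic; only log-subdivergences are allowed. -/
theorem IsCountertermPair.isLogOn_of_uv (hZ : IsCountertermPair D K φ Z Z') (hG : G.IsScaleless)
    (hsub : G.HasOnlyLogSubdivergences D) {a b : G.BridgelessSet} (ha : G.IsLogOn D a.1)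
    (h : G.intervalMatrix (fun x => Z x.toAlg) a b ≠ 0) : G.IsLogOn D b.1 := by
  by_cases hab : a.1 ⊆ b.1
  · rw [intervalMatrix_of_subset hab] at h
    by_cases h1 : G.intervalClass a.1 b.1 = 1
    · rwa [← (hG.intervalClass_eq_one_iff b.2 hab).1 h1]
    · obtain ⟨R⟩ := hG.nonempty_presentation b.2 hab
      exact hG.isLogOn_of_nonneg hsub b.2 fun v hv =>
        R.localOmega_nonneg_of_nonneg ha (hZ.localOmega_nonneg R.scaleless h1 h) hv
  · exact (h (intervalMatrix_of_not_subset hab)).elim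

/-- A nonzero entry makes the degrees of `b / a` nonpositive, and those of `a` are nonpositive for
want of worse than logarithmic subdivergences. Together they add up to the zero degrees of `b`. -/
theorem IsCountertermPair.isLogOn_of_ir (hZ : IsCountertermPair D K φ Z Z') (hG : G.IsScaleless)
    (hsub : G.HasOnlyLogSubdivergences D) {a b : G.BridgelessSet} (hb : G.IsLogOn D b.1)
    (h : G.intervalMatrix (fun x => Z' x.toAlg) a b ≠ 0) : G.IsLogOn D a.1 := by
  by_cases hab : a.1 ⊆ b.1
  · rw [intervalMatrix_of_subset hab] at h
    by_cases h1 : G.intervalClass a.1 b.1 = 1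
    · rwa [(hG.intervalClass_eq_one_iff b.2 hab).1 h1]
    · obtain ⟨R⟩ := hG.nonempty_presentation b.2 hab
      exact R.isLogOn_of_nonpos hb (fun v hv => hG.localOmega_nonpos hsub a.2 hv)
        (hZ.localOmega_nonpos R.scaleless h1 h)
  · exact (h (intervalMatrix_of_not_subset hab)).elim

theorem IsCountertermPair.intervalMatrix_mul_eq_zero (hZ : IsCountertermPair D K φ Z Z')
    (hK : IsSubtractionScheme K) (hφ_one : φ 1 = 1)
    (hφ_scaleless : ∀ Λ : MoticGraph P, Λ.1.IsScaleless → Nonempty Λ.1.E → φ (graphElem Λ) = 0)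
    (hG : G.IsScaleless) {a b : G.BridgelessSet} (ha : G.IsLogOn D a.1) (hb : G.IsLogOn D b.1)
    (hab : a.1 ⊆ b.1) (hne : a ≠ b) :
    (G.intervalMatrix (fun x => Z x.toAlg) * G.intervalMatrix fun x => Z' x.toAlg) a b = 0 := by
  obtain ⟨R⟩ := hG.nonempty_presentation b.2 hab
  rw [hG.intervalMatrix_mul _ _ hab]
  refine hZ.moticConv_eq_zero hK hφ_one hφ_scaleless R.scaleless (fun h => hne ?_)
    (R.localOmega_eq_zero ha hb)
  exact Subtype.ext ((hG.intervalClass_eq_one_iff b.2 hab).1 h)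

theorem intervalMatrix_antipode_mul [DecidableEq G.BridgelessSet] (hG : G.IsScaleless)
    (F : MoticAlgebra P →ₐ[ℚ] A) :
    (G.intervalMatrix fun x => F (antipodeClass x)) * G.intervalMatrix (fun x => F x.toAlg) = 1 := by
  refine hG.intervalMatrix_mul_eq_one ?_ ?_ fun x hx hx1 => moticConv_antipode F hx hx1
  · rw [antipodeClass, if_pos rfl, map_one]
  · rw [toAlg_one, map_one]

/-- Both matrices solve the same unitriangular system with coefficients from `Z`, in the rows of
logarithmic `a`. It is solved from `b` downwards, and `isLogOn_of_uv` shows that such a row involves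
only logarithmic sets. -/
theorem IsCountertermPair.ir_eq_uv_antipode (hZ : IsCountertermPair D K φ Z Z')
    (hK : IsSubtractionScheme K) (hφ_one : φ 1 = 1)
    (hφ_scaleless : ∀ Λ : MoticGraph P, Λ.1.IsScaleless → Nonempty Λ.1.E → φ (graphElem Λ) = 0)
    (hG : G.IsScaleless) (hsub : G.HasOnlyLogSubdivergences D) {b : G.BridgelessSet}
    (hb : G.IsLogOn D b.1) (a : G.BridgelessSet) (ha : G.IsLogOn D a.1) (hab : a.1 ⊆ b.1) :
    G.intervalMatrix (fun x => Z' x.toAlg) a b =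
      G.intervalMatrix (fun x => Z (antipodeClass x)) a b := by
  classical
  have hZone : Z (1 : MoticClass P).toAlg = 1 := by rw [toAlg_one, map_one]
  have hZone' : Z' (1 : MoticClass P).toAlg = 1 := by rw [toAlg_one, map_one]
  -- The antipode recursion gives a left inverse; for finite square matrices it is also a right
  -- inverse.
  have hinv := mul_eq_one_comm.1 (intervalMatrix_antipode_mul hG Z)
  induction a using WellFoundedGT.induction with | _ a ih => ?_
  by_cases hne : a = b
  · subst hne
    rw [hG.intervalMatrix_self hZone', hG.intervalMatrix_self]
    rw [antipodeClass, if_pos rfl, map_one]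
  have h1 := hZ.intervalMatrix_mul_eq_zero hK hφ_one hφ_scaleless hG ha hb hab hne
  have h2 := congrFun (congrFun hinv a) b
  -- The difference of the two systems is a sum over `c` of `Z(c / a)` times the difference of the
  -- entries at `(c, b)`. The summand `c = a` has coefficient `1`, and the others vanish.
  rw [Matrix.one_apply_ne hne, ← h1, Matrix.mul_apply, Matrix.mul_apply, eq_comm, ← sub_eq_zero,
    ← Finset.sum_sub_distrib, Finset.sum_eq_single a, ← mul_sub,
    hG.intervalMatrix_self hZone, one_mul, sub_eq_zero] at h2
  · exact h2
  · intro c _ hca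
    rw [← mul_sub]
    by_cases h0 : G.intervalMatrix (fun x => Z x.toAlg) a c = 0
    · rw [h0, zero_mul]
    have hac : a.1 ⊆ c.1 := by
      by_contra hac
      exact h0 (intervalMatrix_of_not_subset hac)
    by_cases hcb : c.1 ⊆ b.1
    · rw [ih c (lt_of_le_of_ne hac hca.symm) (hZ.isLogOn_of_uv hG hsub ha h0) hcb, sub_self,
        mul_zero]
    · rw [intervalMatrix_of_not_subset hcb, intervalMatrix_of_not_subset hcb, sub_self, mul_zero]
  · exact fun h => (h (Finset.mem_univ _)).elim

/-- The mirror image: the columns of logarithmic `b` are solved from `a` upwards, with coefficients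
from `Z'`, and the left inverse is what is needed. -/
theorem IsCountertermPair.uv_eq_ir_antipode (hZ : IsCountertermPair D K φ Z Z')
    (hK : IsSubtractionScheme K) (hφ_one : φ 1 = 1)
    (hφ_scaleless : ∀ Λ : MoticGraph P, Λ.1.IsScaleless → Nonempty Λ.1.E → φ (graphElem Λ) = 0)
    (hG : G.IsScaleless) (hsub : G.HasOnlyLogSubdivergences D) {a : G.BridgelessSet}
    (ha : G.IsLogOn D a.1) (b : G.BridgelessSet) (hb : G.IsLogOn D b.1) (hab : a.1 ⊆ b.1) :
    G.intervalMatrix (fun x => Z x.toAlg) a b =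
      G.intervalMatrix (fun x => Z' (antipodeClass x)) a b := by
  classical
  have hZone : Z (1 : MoticClass P).toAlg = 1 := by rw [toAlg_one, map_one]
  have hZone' : Z' (1 : MoticClass P).toAlg = 1 := by rw [toAlg_one, map_one]
  have hinv := intervalMatrix_antipode_mul hG Z'
  induction b using WellFoundedLT.induction with | _ b ih => ?_
  by_cases hne : a = b
  · subst hne
    rw [hG.intervalMatrix_self hZone, hG.intervalMatrix_self]
    rw [antipodeClass, if_pos rfl, map_one]
  have h1 := hZ.intervalMatrix_mul_eq_zero hK hφ_one hφ_scaleless hG ha hb hab hne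
  have h2 := congrFun (congrFun hinv a) b
  rw [Matrix.one_apply_ne hne, ← h1, Matrix.mul_apply, Matrix.mul_apply, eq_comm, ← sub_eq_zero,
    ← Finset.sum_sub_distrib, Finset.sum_eq_single b, ← sub_mul,
    hG.intervalMatrix_self hZone', mul_one, sub_eq_zero] at h2
  · exact h2
  · intro c _ hcb'
    rw [← sub_mul]
    by_cases h0 : G.intervalMatrix (fun x => Z' x.toAlg) c b = 0
    · rw [h0, mul_zero]
    have hcb : c.1 ⊆ b.1 := by
      by_contra hcb
      exact h0 (intervalMatrix_of_not_subset hcb)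
    by_cases hac : a.1 ⊆ c.1
    · rw [ih c (lt_of_le_of_ne hcb hcb') (hZ.isLogOn_of_ir hG hsub hb h0) hac, sub_self,
        zero_mul]
    · rw [intervalMatrix_of_not_subset hac, intervalMatrix_of_not_subset hac, sub_self, zero_mul]
  · exact fun h => (h (Finset.mem_univ _)).elim

end Counterterms

end MoticConvolution

theorem mainTheorem3 {P : Type u} [AddCommGroup P] {A : Type v} [CommRing A] [Algebra ℚ A]
    (D : ℕ) (K : A →+ A) (hK : IsSubtractionScheme K)
    (φ : MoticAlgebra P →ₗ[ℚ] A) (hφ_one : φ 1 = 1)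
    (hφ_scaleless : ∀ Λ : MoticGraph P, Λ.1.IsScaleless → Nonempty Λ.1.E → φ (graphElem Λ) = 0)
    (Z Z' : MoticAlgebra P →ₐ[ℚ] A) (hZ : IsCountertermPair D K φ Z Z')
    (Γ : MoticGraph P) (hscaleless : Γ.1.IsScaleless) (hlog : Γ.1.IsLogDivergent D)
    (hsub : Γ.1.HasOnlyLogSubdivergences D) :
    Z' (graphElem Γ) = Z (antipode (graphElem Γ)) ∧
      Z (graphElem Γ) = Z' (antipode (graphElem Γ)) := by
  let a : Γ.1.BridgelessSet := ⟨∅, bridgeless_empty⟩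
  let b : Γ.1.BridgelessSet := ⟨Set.univ, hscaleless.isMotic_iff.1 Γ.2⟩
  have ha : Γ.1.IsLogOn D a.1 := fun v ⟨e, he, _⟩ => he.elim
  have hb : Γ.1.IsLogOn D b.1 := fun v _ => isLogDivergent_iff.1 hlog v
  have hab : a.1 ⊆ b.1 := Set.empty_subset _
  have h1 := hZ.ir_eq_uv_antipode hK hφ_one hφ_scaleless hscaleless hsub hb a ha hab
  have h2 := hZ.uv_eq_ir_antipode hK hφ_one hφ_scaleless hscaleless hsub ha b hb hab
  rw [intervalMatrix_of_subset hab, intervalMatrix_of_subset hab] at h1 h2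
  rw [intervalClass_empty_univ hscaleless] at h1 h2
  rw [graphElem, antipode_toAlg]
  exact ⟨h1, h2⟩
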